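/- Let $d\ge 1$, let $r>0$ be the radius of a ball of volume $1$ in $\mathbb{R}^d$, and let $B_r(x)$ denote the open ball of radius $r$ around $x$. Let $\Lambda\subset\mathbb{R}^d$ be compact with volume $n=|\Lambda|>0$, put $\Lambda_{\mathrm{Int}}=\{x\in\Lambda:\mathrm{dist}(x,\Lambda^c)\ge r\}$, and let $\tau\subseteq\Lambda_{\mathrm{Int}}$ be any measurable set (the boundary condition, a set of forbidden locations). Let $\Omega_\Lambda^\tau$ be the set of all finite sets $X\subset\Lambda_{\mathrm{Int}}\setminus\tau$ whose points are at pairwise distance at least $2r$, with the $\sigma$-algebra generated by the maps $X\mapsto|X\cap B|$, $B$ Borel. Let $\gamma\in(0,1)$ and $\lambda=(1-\gamma)2^{1-d}$. The hard sphere model $\mu_\Lambda^\tau$ is the law on $\Omega_\Lambda^\tau$ of a Poisson point process of intensity $\lambda$ on $\Lambda_{\mathrm{Int}}\setminus\tau$ conditioned on its points being at pairwise distance at least $2r$. The single-center dynamics is the Markov chain on $\Omega_\Lambda^\tau$ that, from $X_t$, picks $x\in\Lambda$ uniformly at random; with probability $1/(1+\lambda)$ it sets $X_{t+1}=X_t\setminus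 B_r(x)$; with probability $\lambda/(1+\lambda)$ it sets $X_{t+1}=X_t\cup\{x\}$ if this set belongs to $\Omega_\Lambda^\tau$, and $X_{t+1}=X_t$ otherwise. For a Markov chain with stationary law $\mu$, let $t_{\mathrm{mix}}(\varepsilon)=\sup_{p^{(0)}}\min\{t\in\mathbb{Z}_{\ge0}:\|p^{(t)}-\mu\|_{TV}\le\varepsilon\}$, where the supremum is over all initial probability distributions $p^{(0)}$, $p^{(t)}$ is the law after $t$ steps, and $\|\nu-\nu'\|_{TV}=\sup_A|\nu(A)-\nu'(A)|$ over measurable sets $A$. Theorem. The law $\mu_\Lambda^\tau$ is a probability measure and is the unique stationary probability distribution of the single-center dynamics on $\Omega_\Lambda^\tau$, and for every $\varepsilon>0$ its mixing time satisfies $$t_{\mathrm{mix}}(\varepsilon)\le \max\left\{0,\ \left\lceil\frac{4n\left(\log(2^{d+2}n)+\log(1/\varepsilon)\right)}{\gamma}\right\rceil\right\}.$$ (If $n\ge1$ and $\varepsilon\le1$ the maximum with $0$ can be omitted.) -/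

import Mathlib

open MeasureTheory ProbabilityTheory
open scoped ENNReal

/-! ## Finite point configurations -/

/-- A finite point configuration in `α`: a finite set of points. -/
@[ext] structure PointConfig (α : Type*) where
  points : Finset α

namespace PointConfig

variable {α β γ : Type*}

/-- The number of points of the configuration `X` that lie in the set `B`. -/
noncomputable def count (B : Set α) (X : PointConfig α) : ℕ :=
  ((X.points : Set α) ∩ B).ncard

/-- The standard σ-algebra on finite point configurations, generated by the maps that count the
points in measurable sets. -/
noncomputable instance [MeasurableSpace α] : MeasurableSpace (PointConfig α) :=
  ⨆ (B : Set α) (_ : MeasurableSet B), MeasurableSpace.comap (count B) ⊤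

open Classical in
/-- The configuration with the point `x` added. -/
noncomputable def add (X : PointConfig α) (x : α) : PointConfig α :=
  ⟨insert x X.points⟩

open Classical in
/-- The configuration `X \ B_r(x)`, with all points at distance less than `r` from `x` removed. -/
noncomputable def deleteBall [PseudoMetricSpace α] (r : ℝ) (X : PointConfig α) (x : α) :
    PointConfig α :=
  ⟨X.points.filter fun y => y ∉ Metric.ball x r⟩

open Classical in
/-- The configuration of the values of a finite sequence of points. -/
noncomputable def ofTuple {k : ℕ} (x : Fin k → α) : PointConfig α :=
  ⟨Finset.univ.image x⟩

theorem count_eq_sum (B : Set α) (X : PointConfig α) :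
    count B X = ∑ y ∈ X.points, B.indicator (fun _ => 1) y := by
  classical
  have h : ((X.points : Set α) ∩ B) = ((X.points.filter fun y => y ∈ B : Finset α) : Set α) := by
    ext y; simp
  rw [count, h, Set.ncard_coe_finset, Finset.card_filter]
  simp [Set.indicator_apply]

theorem measurable_count [MeasurableSpace α] {B : Set α} (hB : MeasurableSet B) :
    Measurable (count B) := by
  rw [measurable_iff_comap_le]
  exact le_iSup₂_of_le B hB le_rfl

theorem measurable_of_count [MeasurableSpace α] [MeasurableSpace γ] {f : γ → PointConfig α}
    (h : ∀ B, MeasurableSet B → Measurable fun c => count B (f c)) : Measurable f := by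
  rw [measurable_iff_le_map]
  refine iSup₂_le fun B hB => ?_
  rw [MeasurableSpace.comap_le_iff_le_map]
  exact h B hB

theorem measurable_count_section [MeasurableSpace α] [MeasurableSpace β] {C : Set (α × β)}
    (hC : MeasurableSet C) :
    Measurable fun p : PointConfig α × β => count {y | (y, p.2) ∈ C} p.1 := by
  induction C, hC using MeasurableSpace.induction_on_inter generateFrom_prod.symm
    isPiSystem_prod with
  | empty => simp [count]
  | basic t ht =>
    obtain ⟨A, hA, B, hB, rfl⟩ := ht
    have h : (fun p : PointConfig α × β => count {y | (y, p.2) ∈ A ×ˢ B} p.1)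
        = fun p => count A p.1 * B.indicator (fun _ => 1) p.2 := by
      funext p
      by_cases hp : p.2 ∈ B <;> simp [hp, count]
    rw [h]
    exact ((measurable_count hA).comp measurable_fst).mul
      ((measurable_const.indicator hB).comp measurable_snd)
  | compl t ht ih =>
    have h : (fun p : PointConfig α × β => count {y | (y, p.2) ∈ tᶜ} p.1)
        = fun p => count Set.univ p.1 - count {y | (y, p.2) ∈ t} p.1 := by
      funext p
      refine (Nat.sub_eq_of_eq_add ?_).symm
      simp only [count_eq_sum, ← Finset.sum_add_distrib]
      refine Finset.sum_congr rfl fun y _ => ?_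
      by_cases hy : (y, p.2) ∈ t <;> simp [hy]
    rw [h]
    exact ((measurable_count MeasurableSet.univ).comp measurable_fst).sub ih
  | iUnion f hd hf ih =>
    have h : ∀ p : PointConfig α × β, ((count {y | (y, p.2) ∈ ⋃ i, f i} p.1 : ℕ) : ℝ≥0∞)
        = ∑' i, ((count {y | (y, p.2) ∈ f i} p.1 : ℕ) : ℝ≥0∞) := by
      intro p
      simp only [count_eq_sum, Nat.cast_sum]
      rw [Summable.tsum_finsetSum fun _ _ => ENNReal.summable]
      refine Finset.sum_congr rfl fun y _ => ?_
      by_cases hy : ∃ i, (y, p.2) ∈ f i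
      · obtain ⟨i, hi⟩ := hy
        rw [tsum_eq_single i]
        · have : ∃ i, (y, p.2) ∈ f i := ⟨i, hi⟩
          simp [hi, this]
        · intro j hj
          have : (y, p.2) ∉ f j := fun hj' =>
            Set.disjoint_left.1 (hd hj) hj' hi
          simp [this]
      · simp only [not_exists] at hy
        simp [hy]
    have hm : Measurable fun p : PointConfig α × β =>
        ((count {y | (y, p.2) ∈ ⋃ i, f i} p.1 : ℕ) : ℝ≥0∞) := by
      simp_rw [h]
      exact Measurable.tsum fun i => measurable_from_top.comp (ih i)
    refine measurable_to_countable' fun k => ?_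
    have : (fun p : PointConfig α × β => count {y | (y, p.2) ∈ ⋃ i, f i} p.1) ⁻¹' {k}
        = (fun p : PointConfig α × β =>
          ((count {y | (y, p.2) ∈ ⋃ i, f i} p.1 : ℕ) : ℝ≥0∞)) ⁻¹' {(k : ℝ≥0∞)} := by
      ext p; simp
    rw [this]
    exact hm (measurableSet_singleton _)

theorem measurableSet_forall_notMem [MeasurableSpace α] [MeasurableSpace β] {C : Set (α × β)}
    (hC : MeasurableSet C) :
    MeasurableSet {p : PointConfig α × β | ∀ y ∈ p.1.points, (y, p.2) ∉ C} := by
  have h : {p : PointConfig α × β | ∀ y ∈ p.1.points, (y, p.2) ∉ C}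
      = (fun p : PointConfig α × β => count {y | (y, p.2) ∈ C} p.1) ⁻¹' {0} := by
    ext p
    simp [count_eq_sum]
  rw [h]
  exact measurable_count_section hC (measurableSet_singleton _)

theorem measurable_add [MeasurableSpace α] [MeasurableEq α] :
    Measurable fun p : PointConfig α × α => p.1.add p.2 := by
  classical
  refine measurable_of_count fun B hB => ?_
  have hD := measurableSet_forall_notMem (measurableSet_diagonal (α := α))
  have h : (fun p : PointConfig α × α => count B (p.1.add p.2))
      = fun p => count B p.1 + {p : PointConfig α × α |
          ∀ y ∈ p.1.points, (y, p.2) ∉ Set.diagonal α}.indicator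
            (fun p => B.indicator (fun _ => 1) p.2) p := by
    funext p
    rw [count_eq_sum, count_eq_sum]
    by_cases hp : p.2 ∈ p.1.points
    · have : ¬ ∀ y ∈ p.1.points, y ≠ p.2 := fun h => h _ hp rfl
      simp [add, hp]
    · have : ∀ y ∈ p.1.points, y ≠ p.2 := fun y hy e => hp (e ▸ hy)
      have hmem : p ∈ {p : PointConfig α × α | ∀ y ∈ p.1.points, (y, p.2) ∉ Set.diagonal α} :=
        fun y hy e => this y hy e
      rw [Set.indicator_of_mem hmem, add, Finset.sum_insert hp, add_comm]
  rw [h]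
  exact ((measurable_count hB).comp measurable_fst).add
    (((measurable_const.indicator hB).comp measurable_snd).indicator hD)

theorem measurable_deleteBall [PseudoMetricSpace α] [SecondCountableTopology α]
    [MeasurableSpace α] [OpensMeasurableSpace α] (r : ℝ) :
    Measurable fun p : PointConfig α × α => p.1.deleteBall r p.2 := by
  classical
  refine measurable_of_count fun B hB => ?_
  have hC : MeasurableSet {q : α × α | q.1 ∈ B ∧ r ≤ dist q.1 q.2} :=
    (measurable_fst hB).inter (measurableSet_le measurable_const measurable_dist)
  have h : (fun p : PointConfig α × α => count B (p.1.deleteBall r p.2))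
      = fun p => count {y | (y, p.2) ∈ {q : α × α | q.1 ∈ B ∧ r ≤ dist q.1 q.2}} p.1 := by
    funext p
    simp only [count]
    congr 1
    ext y
    simp [deleteBall]
    tauto
  rw [h]
  exact measurable_count_section hC

theorem measurable_ofTuple [MeasurableSpace α] [MeasurableEq α] (k : ℕ) :
    Measurable (ofTuple : (Fin k → α) → PointConfig α) := by
  classical
  induction k with
  | zero =>
    have : (ofTuple : (Fin 0 → α) → PointConfig α) = fun _ => ⟨∅⟩ := by
      funext x; simp [ofTuple]
    rw [this]
    exact measurable_const
  | succ k ih =>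
    have : (ofTuple : (Fin (k + 1) → α) → PointConfig α)
        = fun x => (ofTuple fun i => x (Fin.succ i)).add (x 0) := by
      funext x
      ext y
      simp [ofTuple, add, Fin.exists_fin_succ, eq_comm]
    rw [this]
    exact measurable_add.comp ((ih.comp (measurable_pi_lambda _ fun i =>
      measurable_pi_apply _)).prodMk (measurable_pi_apply 0))

end PointConfig

/-! ## Mixing time of a Markov chain -/

/-- The total variation distance `sup_A |μ(A) - ν(A)|`, over measurable sets `A`. -/
noncomputable def tvDist {Ω : Type*} [MeasurableSpace Ω] (μ ν : Measure Ω) : ℝ :=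
  ⨆ A : {A : Set Ω // MeasurableSet A}, |μ.real A - ν.real A|

/-- The law after `t` steps of the Markov chain with transition kernel `κ` and initial law `p`. -/
noncomputable def lawAfter {Ω : Type*} [MeasurableSpace Ω] (κ : Kernel Ω Ω) (p : Measure Ω)
    (t : ℕ) : Measure Ω :=
  (fun q : Measure Ω => q.bind κ)^[t] p

/-- The mixing time `sup_p min {t : ‖p⁽ᵗ⁾ - μ‖ ≤ ε}` of the chain with transition kernel `κ` and
stationary law `μ`, over all initial laws `p`; it is `⊤` when it is not finite. -/
noncomputable def mixingTime {Ω : Type*} [MeasurableSpace Ω] (κ : Kernel Ω Ω) (μ : Measure Ω)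
    (ε : ℝ) : ℕ∞ :=
  ⨆ p : ProbabilityMeasure Ω, ⨅ (t : ℕ) (_ : tvDist (lawAfter κ p t) μ ≤ ε), (t : ℕ∞)

/-! ## The hard sphere model -/

namespace HardSphere

/-- The law of the Poisson point process of intensity `lam` on the set `S` of finite volume: the
number of points is `k` with probability `e^{-lam |S|} (lam |S|)^k / k!`, and given this the points
are independent and uniform in `S`. -/
noncomputable def poissonProcess {d : ℕ} (lam : ℝ) (S : Set (EuclideanSpace ℝ (Fin d))) :
    Measure (PointConfig (EuclideanSpace ℝ (Fin d))) :=
  Measure.sum fun k : ℕ =>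
    ENNReal.ofReal (Real.exp (-(lam * volume.real S)) * lam ^ k / (k.factorial : ℝ)) •
      (Measure.pi fun _ : Fin k => volume.restrict S).map PointConfig.ofTuple

/-- The points of `Λ` at distance at least `r` from the complement of `Λ`. -/
def interiorSet {d : ℕ} (r : ℝ) (Λ : Set (EuclideanSpace ℝ (Fin d))) :
    Set (EuclideanSpace ℝ (Fin d)) :=
  {x ∈ Λ | ENNReal.ofReal r ≤ Metric.infEDist x Λᶜ}

/-- The configurations whose points are at pairwise distance at least `2 r`. -/
def packings (d : ℕ) (r : ℝ) : Set (PointConfig (EuclideanSpace ℝ (Fin d))) :=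
  {X | ∀ x ∈ X.points, ∀ y ∈ X.points, x ≠ y → 2 * r ≤ dist x y}

/-- The set of configurations of the hard sphere model on `Λ`, for spheres of radius `r`, with
boundary condition `τ` (the set of forbidden locations). -/
def configs {d : ℕ} (r : ℝ) (Λ τ : Set (EuclideanSpace ℝ (Fin d))) :
    Set (PointConfig (EuclideanSpace ℝ (Fin d))) :=
  {X | (∀ x ∈ X.points, x ∈ interiorSet r Λ \ τ) ∧ X ∈ packings d r}

/-- The hard sphere model on `Λ` at fugacity `lam` with boundary condition `τ`: the Poisson point
process of intensity `lam` on the allowed locations, conditioned to be a packing, as a measure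
on the space of configurations. -/
noncomputable def hardSphereLaw {d : ℕ} (r lam : ℝ) (Λ τ : Set (EuclideanSpace ℝ (Fin d))) :
    Measure (configs r Λ τ) :=
  (ProbabilityTheory.cond (poissonProcess lam (interiorSet r Λ \ τ)) (packings d r)).comap
    Subtype.val

theorem measurableSet_interiorSet {d : ℕ} (r : ℝ) {Λ : Set (EuclideanSpace ℝ (Fin d))}
    (hΛ : MeasurableSet Λ) : MeasurableSet (interiorSet r Λ) :=
  hΛ.inter (measurableSet_le measurable_const measurable_infEDist)

/-- The result of removing all centers at distance less than `r` from `x`. -/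
noncomputable def removeStep {d : ℕ} {r : ℝ} {Λ τ : Set (EuclideanSpace ℝ (Fin d))}
    (X : configs r Λ τ) (x : EuclideanSpace ℝ (Fin d)) : configs r Λ τ :=
  ⟨X.1.deleteBall r x, by
    classical
    refine ⟨fun y hy => X.2.1 y (Finset.mem_filter.1 hy).1, fun y hy z hz => ?_⟩
    exact X.2.2 y (Finset.mem_filter.1 hy).1 z (Finset.mem_filter.1 hz).1⟩

open Classical in
/-- The result of attempting to add a center at `x`. -/
noncomputable def addStep {d : ℕ} {r : ℝ} {Λ τ : Set (EuclideanSpace ℝ (Fin d))}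
    (X : configs r Λ τ) (x : EuclideanSpace ℝ (Fin d)) : configs r Λ τ :=
  if h : X.1.add x ∈ configs r Λ τ then ⟨X.1.add x, h⟩ else X

theorem measurable_removeStep {d : ℕ} {r : ℝ} {Λ τ : Set (EuclideanSpace ℝ (Fin d))} :
    Measurable fun p : configs r Λ τ × EuclideanSpace ℝ (Fin d) => removeStep p.1 p.2 :=
  ((PointConfig.measurable_deleteBall r).comp
    ((measurable_subtype_coe.comp measurable_fst).prodMk measurable_snd)).subtype_mk

theorem measurable_addStep {d : ℕ} {r : ℝ} {Λ τ : Set (EuclideanSpace ℝ (Fin d))}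
    (hΛ : MeasurableSet Λ) (hτ : MeasurableSet τ) :
    Measurable fun p : configs r Λ τ × EuclideanSpace ℝ (Fin d) => addStep p.1 p.2 := by
  classical
  let e : configs r Λ τ × EuclideanSpace ℝ (Fin d) →
      PointConfig (EuclideanSpace ℝ (Fin d)) × EuclideanSpace ℝ (Fin d) := fun p => (p.1.1, p.2)
  have he : Measurable e :=
    (measurable_subtype_coe.comp measurable_fst).prodMk measurable_snd
  let C : Set (EuclideanSpace ℝ (Fin d) × EuclideanSpace ℝ (Fin d)) :=
    {q | q.1 ≠ q.2 ∧ dist q.1 q.2 < 2 * r}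
  have hC : MeasurableSet C :=
    measurableSet_diagonal.compl.inter (measurableSet_lt measurable_dist measurable_const)
  have hmem : ∀ p : configs r Λ τ × EuclideanSpace ℝ (Fin d),
      p.1.1.add p.2 ∈ configs r Λ τ ↔
        p.2 ∈ interiorSet r Λ \ τ ∧ ∀ y ∈ p.1.1.points, (y, p.2) ∉ C := by
    intro p
    have h1 := p.1.2.1
    have h2 := p.1.2.2
    simp only [packings, Set.mem_ofPred_eq] at h2
    simp only [configs, packings, PointConfig.add, Set.mem_ofPred_eq, Finset.mem_insert, C,
      not_and, not_lt]
    constructor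
    · exact fun h => ⟨h.1 _ (Or.inl rfl), fun y hy hne => h.2 y (Or.inr hy) _ (Or.inl rfl) hne⟩
    · rintro ⟨h3, h4⟩
      refine ⟨?_, ?_⟩
      · rintro x (rfl | hx)
        exacts [h3, h1 x hx]
      · rintro x (rfl | hx) y (rfl | hy) hne
        · exact absurd rfl hne
        · rw [dist_comm]; exact h4 y hy hne.symm
        · exact h4 x hx hne
        · exact h2 x hx y hy hne
  have hA : MeasurableSet {p : configs r Λ τ × EuclideanSpace ℝ (Fin d) |
      p.1.1.add p.2 ∈ configs r Λ τ} := by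
    simp_rw [hmem]
    exact (measurable_snd ((measurableSet_interiorSet r hΛ).diff hτ)).inter
      (he (PointConfig.measurableSet_forall_notMem hC))
  have hval : Measurable fun p : configs r Λ τ × EuclideanSpace ℝ (Fin d) =>
      (addStep p.1 p.2 : PointConfig (EuclideanSpace ℝ (Fin d))) := by
    have h : (fun p : configs r Λ τ × EuclideanSpace ℝ (Fin d) =>
        (addStep p.1 p.2 : PointConfig (EuclideanSpace ℝ (Fin d)))) = fun p =>
          if p.1.1.add p.2 ∈ configs r Λ τ then p.1.1.add p.2 else p.1.1 := by
      funext p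
      by_cases hp : p.1.1.add p.2 ∈ configs r Λ τ <;> simp [addStep, hp]
    rw [h]
    exact Measurable.ite hA (PointConfig.measurable_add.comp he)
      (measurable_subtype_coe.comp measurable_fst)
  exact hval.subtype_mk

/-- The transition kernel of the single-center dynamics at fugacity `lam`: with `x` uniform in `Λ`,
all centers in `B_r(x)` are removed with probability `1 / (1 + lam)`, and a center at `x` is
attempted to be added with probability `lam / (1 + lam)`. -/
noncomputable def singleCenterDynamics {d : ℕ} (r lam : ℝ)
    {Λ τ : Set (EuclideanSpace ℝ (Fin d))} (hΛ : MeasurableSet Λ) (hτ : MeasurableSet τ) :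
    Kernel (configs r Λ τ) (configs r Λ τ) where
  toFun X :=
    ENNReal.ofReal (1 / (1 + lam)) •
        (ProbabilityTheory.cond volume Λ).map (removeStep X) +
      ENNReal.ofReal (lam / (1 + lam)) •
        (ProbabilityTheory.cond volume Λ).map (addStep X)
  measurable' := by
    have key : ∀ f : configs r Λ τ → EuclideanSpace ℝ (Fin d) → configs r Λ τ,
        (Measurable fun p : configs r Λ τ × EuclideanSpace ℝ (Fin d) => f p.1 p.2) →
        ∀ s, MeasurableSet s →
          Measurable fun X => (ProbabilityTheory.cond volume Λ).map (fun x => f X x) s := by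
      intro f hf s hs
      have h : (fun X => (ProbabilityTheory.cond volume Λ).map (fun x => f X x) s)
          = fun X => (volume Λ)⁻¹ * (volume.restrict Λ) (Prod.mk X ⁻¹'
              ((fun p : configs r Λ τ × EuclideanSpace ℝ (Fin d) => f p.1 p.2) ⁻¹' s)) := by
        funext X
        have hfX : Measurable fun x => f X x := hf.comp measurable_prodMk_left
        rw [Measure.map_apply hfX hs]
        rfl
      rw [h]
      exact (measurable_measure_prodMk_left (hf hs)).const_mul _
    refine Measure.measurable_of_measurable_coe _ fun s hs => ?_
    simp only [Measure.add_apply, Measure.smul_apply, smul_eq_mul]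
    exact ((key _ measurable_removeStep s hs).const_mul _).add
      ((key _ (measurable_addStep hΛ hτ) s hs).const_mul _)

end HardSphere

/-! The proof is a path-coupling argument, phrased dually as contraction of a weighted Lipschitz
seminorm under the transition operator `stepOp`. Write F_v(X) for the volume of the free points
(allowed and at distance at least 2r from X) inside B_{2r}(v), and D = 2^d for the volume of
B_{2r}(v). A function g has seminorm at most L if adding v to X changes it by at most L(a +
cF_v(X)). A constant weight (c = 0) would contract only for λ < 2^{-d}; charging a discrepancy v
according to the room around it gains the factor 2.

One step affects such a difference as follows. Picking x in B_r(v) for deletion removes the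
discrepancy, with volume 1. Other deletions enlarge F_v, but a blocked point is freed only if a
given blocker is deleted, so the total gain is at most D - F_v (`integral_freeVol_deleteBall_le`).
Inserting x near v creates a second discrepancy at x, while every insertion shrinks free volumes; by
symmetry of the double integrals these effects cancel up to aF_v (`integral_addFree_sub_le`). The
total drift is at most -a - 2cF + cD + λaF, which the choice a = 1/2 + γ/4, cD = 1/2 - γ/4 makes at
most -γ/2. Since a + cD = 1, each step contracts the seminorm by at least exp(-γ/(4n)).

A configuration has at most n points, its r-balls being disjoint, of volume 1 and contained in Λ.
Telescoping down to the empty configuration, any two laws after t steps differ on every event by at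
most 4n exp(-tγ/(4n)) (`abs_lawAfter_sub_le`). This gives both the mixing time and the uniqueness of
the stationary law. Stationarity of the hard sphere law is a balance between insertions and
deletions, supplied by the Mecke formula (`setLIntegral_configs_step`). -/

namespace MeasureTheory

/-! ### Fubini for the measures of sections. -/

theorem integral_measureReal_prodMk_left {α β : Type*} [MeasurableSpace α] [MeasurableSpace β]
    (μ : Measure α) (ν : Measure β) [IsFiniteMeasure μ] [IsFiniteMeasure ν] {W : Set (α × β)}
    (hW : MeasurableSet W) : ∫ x, ν.real (Prod.mk x ⁻¹' W) ∂μ = (μ.prod ν).real W := by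
  simp only [measureReal_def]
  rw [integral_toReal (measurable_measure_prodMk_left hW).aemeasurable
    (Filter.Eventually.of_forall fun x => measure_lt_top _ _), Measure.prod_apply hW]

theorem integral_measureReal_prodMk_swap {α β : Type*} [MeasurableSpace α] [MeasurableSpace β]
    (μ : Measure α) (ν : Measure β) [IsFiniteMeasure μ] [IsFiniteMeasure ν] {W : Set (α × β)}
    (hW : MeasurableSet W) : ∫ x, ν.real {y | (x, y) ∈ W} ∂μ = ∫ y, μ.real {x | (x, y) ∈ W} ∂ν := by
  have h1 := integral_measureReal_prodMk_left μ ν hW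
  have h2 := integral_measureReal_prodMk_left ν μ (measurable_swap hW)
  have h3 : (ν.prod μ).real (Prod.swap ⁻¹' W) = (μ.prod ν).real W := by
    rw [← Measure.prod_swap (μ := μ) (ν := ν), measureReal_def, measureReal_def,
      Measure.map_apply measurable_swap (measurable_swap hW), ← Set.preimage_comp,
      Prod.swap_swap_eq, Set.preimage_id]
  rw [h3] at h2
  exact h1.trans h2.symm

theorem measurable_measureReal_prodMk_left {α β : Type*} [MeasurableSpace α] [MeasurableSpace β]
    (ν : Measure β) [SFinite ν] {W : Set (α × β)} (hW : MeasurableSet W) :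
    Measurable fun x => ν.real {y | (x, y) ∈ W} :=
  (measurable_measure_prodMk_left hW).ennreal_toReal

theorem integrable_measureReal_prodMk_left {α β : Type*} [MeasurableSpace α] [MeasurableSpace β]
    (μ : Measure α) (ν : Measure β) [IsFiniteMeasure μ] [IsFiniteMeasure ν] {W : Set (α × β)}
    (hW : MeasurableSet W) : Integrable (fun x => ν.real {y | (x, y) ∈ W}) μ :=
  Integrable.of_bound (measurable_measureReal_prodMk_left ν hW).aestronglyMeasurable
    (ν.real Set.univ) (Filter.Eventually.of_forall fun x => by
      rw [Real.norm_of_nonneg measureReal_nonneg]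
      exact measureReal_mono (Set.subset_univ _))

end MeasureTheory

/-! ### Adding points to and deleting balls from a configuration. -/

namespace PointConfig

variable {α : Type*}

theorem add_of_mem {X : PointConfig α} {x : α} (hx : x ∈ X.points) : X.add x = X := by
  classical
  ext y
  simp only [add, Finset.mem_insert]
  exact ⟨fun h => h.elim (fun h => h ▸ hx) id, Or.inr⟩

theorem mem_add {X : PointConfig α} {x y : α} : y ∈ (X.add x).points ↔ y = x ∨ y ∈ X.points := by
  classical
  simp [add]

theorem mem_deleteBall [PseudoMetricSpace α] {r : ℝ} {X : PointConfig α} {x y : α} :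
    y ∈ (X.deleteBall r x).points ↔ y ∈ X.points ∧ r ≤ dist y x := by
  classical
  simp [deleteBall]

theorem add_comm (X : PointConfig α) (x y : α) : (X.add x).add y = (X.add y).add x := by
  ext z
  simp only [mem_add]
  tauto

theorem deleteBall_add_of_lt [PseudoMetricSpace α] {r : ℝ} (X : PointConfig α) {v x : α}
    (h : dist v x < r) : (X.add v).deleteBall r x = X.deleteBall r x := by
  ext z
  simp only [mem_deleteBall, mem_add]
  constructor
  · rintro ⟨rfl | h1, h2⟩
    · exact absurd h2 (not_le.2 h)
    · exact ⟨h1, h2⟩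
  · exact fun h => ⟨Or.inr h.1, h.2⟩

theorem deleteBall_add_of_le [PseudoMetricSpace α] {r : ℝ} (X : PointConfig α) {v x : α}
    (h : r ≤ dist v x) : (X.add v).deleteBall r x = (X.deleteBall r x).add v := by
  ext z
  simp only [mem_deleteBall, mem_add]
  constructor
  · rintro ⟨rfl | h1, h2⟩
    · exact Or.inl rfl
    · exact Or.inr ⟨h1, h2⟩
  · rintro (rfl | h1)
    exacts [⟨Or.inl rfl, h⟩, ⟨Or.inr h1.1, h1.2⟩]

end PointConfig

/-! ### Free points, the transition operator, and the effect of a deletion. -/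

namespace HardSphere

open PointConfig

section Dynamics

variable {α : Type*} [MetricSpace α]

/-- The points of `A` at distance at least `R` from all points of `X`. -/
def freeSet (R : ℝ) (A : Set α) (X : PointConfig α) : Set α :=
  {x | x ∈ A ∧ ∀ y ∈ X.points, R ≤ dist y x}

open Classical in
/-- The configuration with `x` added, if `x` is a free point of `A`. -/
noncomputable def addFree (R : ℝ) (A : Set α) (X : PointConfig α) (x : α) : PointConfig α :=
  if x ∈ freeSet R A X then X.add x else X

theorem freeSet_add (R : ℝ) (A : Set α) (X : PointConfig α) (v : α) :
    freeSet R A (X.add v) = freeSet R A X \ Metric.ball v R := by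
  ext x
  simp only [freeSet, mem_add, Set.mem_ofPred_eq, Set.mem_sdiff, Metric.mem_ball, not_lt]
  constructor
  · exact fun h => ⟨⟨h.1, fun y hy => h.2 y (Or.inr hy)⟩, dist_comm v x ▸ h.2 v (Or.inl rfl)⟩
  · rintro ⟨⟨h1, h2⟩, h3⟩
    refine ⟨h1, ?_⟩
    rintro y (rfl | hy)
    exacts [dist_comm x y ▸ h3, h2 y hy]

theorem freeSet_subset (R : ℝ) (A : Set α) (X : PointConfig α) : freeSet R A X ⊆ A :=
  fun _ h => h.1

variable [MeasurableSpace α] [BorelSpace α] [SecondCountableTopology α]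

theorem measurableSet_mem_freeSet (R : ℝ) {A : Set α} (hA : MeasurableSet A) :
    MeasurableSet {p : PointConfig α × α | p.2 ∈ freeSet R A p.1} := by
  have hC : MeasurableSet {q : α × α | dist q.1 q.2 < R} :=
    measurableSet_lt measurable_dist measurable_const
  have h : {p : PointConfig α × α | p.2 ∈ freeSet R A p.1}
      = Prod.snd ⁻¹' A ∩ {p | ∀ y ∈ p.1.points, (y, p.2) ∉ {q : α × α | dist q.1 q.2 < R}} := by
    ext p
    simp [freeSet]
  rw [h]
  exact (measurable_snd hA).inter (measurableSet_forall_notMem hC)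

theorem measurableSet_freeSet (R : ℝ) {A : Set α} (hA : MeasurableSet A) (X : PointConfig α) :
    MeasurableSet (freeSet R A X) :=
  measurable_prodMk_left (measurableSet_mem_freeSet R hA)

theorem measurable_addFree (R : ℝ) {A : Set α} (hA : MeasurableSet A) :
    Measurable fun p : PointConfig α × α => addFree R A p.1 p.2 :=
  Measurable.ite (measurableSet_mem_freeSet R hA) measurable_add measurable_fst

end Dynamics

section Contraction

variable {α : Type*} [MetricSpace α] [MeasureSpace α]

/-- The volume of the free points of `A` at distance less than `R` from `v`. -/
noncomputable def freeVol (R : ℝ) (A : Set α) (v : α) (X : PointConfig α) : ℝ :=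
  (volume : Measure α).real (freeSet R A X ∩ Metric.ball v R)

/-- One step of the single-center dynamics on all finite configurations, as an operator on
functions of the configuration. -/
noncomputable def stepOp (r lam : ℝ) (Λ A : Set α) (g : PointConfig α → ℝ) (X : PointConfig α) :
    ℝ :=
  ((volume : Measure α).real Λ * (1 + lam))⁻¹ *
    ((∫ x in Λ, g (X.deleteBall r x)) + lam * ∫ x in Λ, g (addFree (2 * r) A X x))

/-- Adding the point `v ∈ A` changes `g` by at most `L (a + c F)`, where `F` is the free volume
near `v`. -/
def FreeLipschitz (R a c : ℝ) (A : Set α) (L : ℝ) (g : PointConfig α → ℝ) : Prop :=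
  ∀ X : PointConfig α, ∀ v ∈ A, |g (X.add v) - g X| ≤ L * (a + c * freeVol R A v X)

variable [BorelSpace α] [SecondCountableTopology α]

/-- Deletion only enlarges the free set. The gain is written as the measure of a section in (x, y),
so that Fubini can later exchange the deleted location with the freed point. -/
theorem freeVol_deleteBall (r R : ℝ) {A : Set α} (hA : MeasurableSet A) (hAfin : volume A ≠ ⊤)
    (v : α) (X : PointConfig α) (x : α) :
    freeVol R A v (X.deleteBall r x) = freeVol R A v X +
      (volume.restrict ((A ∩ Metric.ball v R) \ freeSet R A X)).real
        {y | (x, y) ∈ {p : α × α | p.2 ∈ freeSet R A (X.deleteBall r p.1)}} := by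
  have hm := measurableSet_freeSet R hA (X.deleteBall r x)
  rw [freeVol, freeVol, measureReal_restrict_apply (by exact hm)]
  have hsub : freeSet R A X ⊆ freeSet R A (X.deleteBall r x) := fun y hy =>
    ⟨hy.1, fun z hz => hy.2 z (mem_deleteBall.1 hz).1⟩
  rw [← measureReal_union (h₁ := measure_ne_top_of_subset (fun y hy => hy.1.1) hAfin)
    (h₂ := measure_ne_top_of_subset (fun y hy => hy.2.1.1) hAfin)]
  · congr 1
    ext y
    have h1 := @hsub y
    have h2 := @freeSet_subset _ _ R A (X.deleteBall r x) y
    simp only [Set.mem_inter_iff, Set.mem_union, Set.mem_ofPred_eq, Set.mem_sdiff]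
    tauto
  · rw [Set.disjoint_left]
    simp only [Set.mem_inter_iff, Set.mem_ofPred_eq, Set.mem_sdiff]
    tauto
  · exact hm.inter (((hA.inter Metric.isOpen_ball.measurableSet)).diff
      (measurableSet_freeSet R hA X))

/-- A blocked point y has a blocker w in X at distance less than R, and y stays blocked unless x
lies in B_r(w), a set of volume 1. By Fubini the total gain in free volume is at most the blocked
volume in B_R(v), hence at most D - F. The factor |Λ| - 1 is the volume of Λ outside B_r(v). -/
theorem integral_freeVol_deleteBall_le {r R a c D : ℝ} (hc : 0 ≤ c) {Λ A : Set α}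
    (hΛfin : volume Λ ≠ ⊤) (hA : MeasurableSet A) (hAΛ : A ⊆ Λ)
    (hball : ∀ x : α, volume (Metric.ball x r) = 1) {v : α} (hv : Metric.ball v r ⊆ Λ)
    (hD : volume.real (Metric.ball v R) ≤ D) (hDfin : volume (Metric.ball v R) ≠ ⊤)
    (X : PointConfig α) :
    ∫ x in Λ \ Metric.ball v r, (a + c * freeVol R A v (X.deleteBall r x))
      ≤ (volume.real Λ - 1) * (a + c * freeVol R A v X) + c * (D - freeVol R A v X) := by
  have hAfin : volume A ≠ ⊤ := measure_ne_top_of_subset hAΛ hΛfin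
  set Q := (A ∩ Metric.ball v R) \ freeSet R A X with hQ
  set W := {p : α × α | p.2 ∈ freeSet R A (X.deleteBall r p.1)} with hWdef
  have hW : MeasurableSet W := by
    have : Measurable fun p : α × α => (X.deleteBall r p.1, p.2) :=
      ((measurable_deleteBall r).comp (measurable_const.prodMk measurable_fst)).prodMk
        measurable_snd
    exact this (measurableSet_mem_freeSet R hA)
  have hQfin : volume Q ≠ ⊤ := measure_ne_top_of_subset (fun y hy => hy.1.1) hAfin
  have : IsFiniteMeasure (volume.restrict Q) := ⟨by simpa using hQfin.lt_top⟩
  have : IsFiniteMeasure (volume.restrict Λ) := ⟨by simpa using hΛfin.lt_top⟩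
  have : IsFiniteMeasure (volume.restrict (Λ \ Metric.ball v r)) :=
    ⟨by simpa using (measure_ne_top_of_subset Set.sdiff_subset hΛfin).lt_top⟩
  have hvol : volume.real (Λ \ Metric.ball v r) = volume.real Λ - 1 := by
    rw [measureReal_sdiff hv Metric.isOpen_ball.measurableSet,
      measureReal_def volume (Metric.ball v r), hball]
    simp
  have hint := integrable_measureReal_prodMk_left (volume.restrict Λ) (volume.restrict Q) hW
  have hint' := integrable_measureReal_prodMk_left (volume.restrict (Λ \ Metric.ball v r))
    (volume.restrict Q) hW
  have h1 : ∫ x in Λ \ Metric.ball v r, (volume.restrict Q).real {y | (x, y) ∈ W}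
      ≤ volume.real Q := by
    calc _ ≤ ∫ x in Λ, (volume.restrict Q).real {y | (x, y) ∈ W} :=
          setIntegral_mono_set hint (Filter.Eventually.of_forall fun x => measureReal_nonneg)
            Set.sdiff_subset.eventuallyLE
      _ = ∫ y in Q, (volume.restrict Λ).real {x | (x, y) ∈ W} :=
          integral_measureReal_prodMk_swap _ _ hW
      _ ≤ ∫ y in Q, (1 : ℝ) := by
          have hQm : MeasurableSet Q := (hA.inter Metric.isOpen_ball.measurableSet).diff
              (measurableSet_freeSet R hA X)
          refine setIntegral_mono_on ?_ (integrable_const _) hQm fun y hy => ?_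
          · exact integrable_measureReal_prodMk_left (volume.restrict Q) (volume.restrict Λ)
              (measurable_swap hW)
          · have hnf : ¬ ∀ w ∈ X.points, R ≤ dist w y := fun h => hy.2 ⟨hy.1.1, h⟩
            push Not at hnf
            obtain ⟨w, hw, hwy⟩ := hnf
            have hsub : {x | (x, y) ∈ W} ⊆ Metric.ball w r := by
              intro x hx
              by_contra hxw
              refine absurd (hx.2 w (mem_deleteBall.2 ⟨hw, ?_⟩)) (not_le.2 hwy)
              rw [Metric.mem_ball, not_lt, dist_comm] at hxw
              exact hxw
            calc (volume.restrict Λ).real {x | (x, y) ∈ W}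
                ≤ (volume.restrict Λ).real (Metric.ball w r) := measureReal_mono hsub
              _ ≤ volume.real (Metric.ball w r) := by
                  refine ENNReal.toReal_mono (by simp [hball]) (Measure.restrict_apply_le _ _)
              _ = 1 := by simp [measureReal_def, hball]
      _ = volume.real Q := by simp
  have h2 : volume.real Q ≤ D - freeVol R A v X := by
    have : freeVol R A v X + volume.real Q ≤ volume.real (Metric.ball v R) := by
      rw [freeVol, ← measureReal_union
        (h₁ := measure_ne_top_of_subset (fun y hy => hy.2) hDfin)
        (h₂ := measure_ne_top_of_subset (fun y hy => hy.1.2) hDfin)]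
      · exact measureReal_mono (by rintro y (hy | hy); exacts [hy.2, hy.1.2]) hDfin
      · rw [Set.disjoint_left]
        exact fun y hy hy' => hy'.2 hy.1
      · exact (hA.inter Metric.isOpen_ball.measurableSet).diff (measurableSet_freeSet R hA X)
    linarith
  have h3 : ∀ x, a + c * freeVol R A v (X.deleteBall r x) = (a + c * freeVol R A v X) +
      c * (volume.restrict Q).real {y | (x, y) ∈ W} := fun x => by
    rw [freeVol_deleteBall r R hA hAfin v X x]; ring
  simp_rw [h3]
  rw [integral_add (integrable_const _) (hint'.const_mul c), integral_const, integral_const_mul,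
    measureReal_restrict_apply_univ, hvol, smul_eq_mul]
  gcongr
  exact h1.trans h2

/-- For x in B_r(v) the two configurations coincide after deletion. For all other x the point v
survives, and the seminorm bound applies to the thinned configuration. -/
theorem integral_deleteBall_sub_le {r R a c D L : ℝ} (hc : 0 ≤ c) (hL : 0 ≤ L) {Λ A : Set α}
    (hΛ : MeasurableSet Λ) (hΛfin : volume Λ ≠ ⊤) (hA : MeasurableSet A) (hAΛ : A ⊆ Λ)
    (hball : ∀ x : α, volume (Metric.ball x r) = 1) {v : α} (hvA : v ∈ A)
    (hv : Metric.ball v r ⊆ Λ)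
    (hD : volume.real (Metric.ball v R) ≤ D) (hDfin : volume (Metric.ball v R) ≠ ⊤)
    {g : PointConfig α → ℝ} (hg : FreeLipschitz R a c A L g) (X : PointConfig α) :
    ∫ x in Λ, |g ((X.add v).deleteBall r x) - g (X.deleteBall r x)|
      ≤ L * ((volume.real Λ - 1) * (a + c * freeVol R A v X) + c * (D - freeVol R A v X)) := by
  have hAfin : volume A ≠ ⊤ := measure_ne_top_of_subset hAΛ hΛfin
  have : IsFiniteMeasure (volume.restrict (Λ \ Metric.ball v r)) :=
    ⟨by simpa using (measure_ne_top_of_subset Set.sdiff_subset hΛfin).lt_top⟩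
  have hzero : ∀ x ∈ Λ, x ∉ Λ \ Metric.ball v r →
      |g ((X.add v).deleteBall r x) - g (X.deleteBall r x)| = 0 := by
    intro x hx hx'
    have : dist v x < r := by
      by_contra h
      exact hx' ⟨hx, by rwa [Metric.mem_ball, dist_comm]⟩
    rw [deleteBall_add_of_lt X this, sub_self, abs_zero]
  rw [setIntegral_eq_of_subset_of_forall_sdiff_eq_zero hΛ Set.sdiff_subset
    fun x hx => hzero x hx.1 hx.2]
  have hdm : MeasurableSet (Λ \ Metric.ball v r) := hΛ.diff Metric.isOpen_ball.measurableSet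
  have hint : IntegrableOn (fun x => a + c * freeVol R A v (X.deleteBall r x))
      (Λ \ Metric.ball v r) := by
    have hQfin : volume ((A ∩ Metric.ball v R) \ freeSet R A X) ≠ ⊤ :=
      measure_ne_top_of_subset (fun y hy => hy.1.1) hAfin
    have : IsFiniteMeasure (volume.restrict ((A ∩ Metric.ball v R) \ freeSet R A X)) :=
      ⟨by simpa using hQfin.lt_top⟩
    simp_rw [freeVol_deleteBall r R hA hAfin v X]
    have hm : Measurable fun p : α × α => (X.deleteBall r p.1, p.2) :=
      ((measurable_deleteBall r).comp (measurable_const.prodMk measurable_fst)).prodMk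
        measurable_snd
    exact (integrable_const _).add (((integrable_const _).add
      (integrable_measureReal_prodMk_left _ _ (hm (measurableSet_mem_freeSet R hA)))).const_mul c)
  calc _ ≤ ∫ x in Λ \ Metric.ball v r, L * (a + c * freeVol R A v (X.deleteBall r x)) := by
        refine integral_mono_of_nonneg (Filter.Eventually.of_forall fun x => abs_nonneg _)
          (hint.const_mul L) ((ae_restrict_iff' hdm).2 (Filter.Eventually.of_forall fun x hx => ?_))
        have : r ≤ dist v x := by
          rw [dist_comm]; exact not_lt.1 hx.2
        simp only
        rw [deleteBall_add_of_le X this]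
        exact hg _ v hvA
    _ ≤ _ := by
        rw [integral_const_mul]
        exact mul_le_mul_of_nonneg_left
          (integral_freeVol_deleteBall_le hc hΛfin hA hAΛ hball hv hD hDfin X) hL

end Contraction

end HardSphere

/-! ### The effect of an insertion, and contraction in one step. -/

namespace HardSphere

open PointConfig

section Contraction

variable {α : Type*} [MetricSpace α] [MeasureSpace α] [BorelSpace α] [SecondCountableTopology α]

omit [SecondCountableTopology α] in
theorem freeVol_add (R : ℝ) {A : Set α} (hAfin : volume A ≠ ⊤)
    (v x : α) (X : PointConfig α) :
    freeVol R A v (X.add x) = freeVol R A v X -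
      volume.real (freeSet R A X ∩ Metric.ball v R ∩ Metric.ball x R) := by
  rw [freeVol, freeVol, freeSet_add, eq_sub_iff_add_eq]
  have : freeSet R A X \ Metric.ball x R ∩ Metric.ball v R
      = (freeSet R A X ∩ Metric.ball v R) \ Metric.ball x R := by
    ext y; simp only [Set.mem_inter_iff, Set.mem_sdiff]; tauto
  rw [this]
  exact measureReal_sdiff_add_inter Metric.isOpen_ball.measurableSet
    (measure_ne_top_of_subset (fun y hy => hy.1.1) hAfin)

omit [SecondCountableTopology α] in
-- Each free x shrinks the free volume around v by the overlap with B_R(x). If moreover x is within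
-- R of v, it is inserted only into X, which costs one further discrepancy, at x.
theorem abs_addFree_sub_le {R a c L : ℝ} (hc : 0 ≤ c) (hL : 0 ≤ L) {A : Set α}
    (hAfin : volume A ≠ ⊤) {v : α} (hvA : v ∈ A)
    {g : PointConfig α → ℝ} (hg : FreeLipschitz R a c A L g) (X : PointConfig α) (x : α) :
    |g (addFree R A (X.add v) x) - g (addFree R A X x)| ≤
      L * ((a + c * freeVol R A v X) +
        (freeSet R A X ∩ Metric.ball v R).indicator (fun x => a + c * freeVol R A x X) x -
        c * (freeSet R A X).indicator
          (fun x => volume.real (freeSet R A X ∩ Metric.ball v R ∩ Metric.ball x R)) x) := by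
  by_cases hx : x ∈ freeSet R A X
  · by_cases hxv : x ∈ Metric.ball v R
    -- Here v blocks x, so X + v is compared with X + x through X + v + x. This need not be a
    -- packing, which is why the seminorm and `stepOp` live on all finite configurations.
    · have hx' : x ∉ freeSet R A (X.add v) := by
        rw [freeSet_add]; exact fun h => h.2 hxv
      rw [addFree, addFree, if_neg hx', if_pos hx,
        Set.indicator_of_mem (show x ∈ freeSet R A X ∩ Metric.ball v R from ⟨hx, hxv⟩),
        Set.indicator_of_mem hx]
      have h1 := hg (X.add x) v hvA
      have h2 := hg (X.add v) x hx.1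
      rw [PointConfig.add_comm, freeVol_add R hAfin] at h1
      rw [freeVol_add R hAfin] at h2
      -- Both discrepancies lose the same overlap; only the loss at v is kept.
      have h3 : 0 ≤ volume.real (freeSet R A X ∩ Metric.ball x R ∩ Metric.ball v R) :=
        measureReal_nonneg
      have h4 : g (X.add v) - g (X.add x) =
          (g ((X.add v).add x) - g (X.add x)) - (g ((X.add v).add x) - g (X.add v)) := by ring
      rw [h4]
      have h5 : 0 ≤ L * (c * volume.real (freeSet R A X ∩ Metric.ball x R ∩ Metric.ball v R)) := by
        positivity
      refine (abs_sub _ _).trans ?_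
      linarith
    · have hx' : x ∈ freeSet R A (X.add v) := by
        rw [freeSet_add]; exact ⟨hx, hxv⟩
      rw [addFree, addFree, if_pos hx', if_pos hx,
        Set.indicator_of_notMem (fun h => hxv h.2), Set.indicator_of_mem hx]
      have h1 := hg (X.add x) v hvA
      rw [PointConfig.add_comm, freeVol_add R hAfin] at h1
      linarith
  · have hx' : x ∉ freeSet R A (X.add v) := by
      rw [freeSet_add]; exact fun h => hx h.1
    rw [addFree, addFree, if_neg hx', if_neg hx,
      Set.indicator_of_notMem (fun h => hx h.1), Set.indicator_of_notMem hx]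
    have h1 := hg X v hvA
    linarith

/-- With S the free set and T = S ∩ B_R(v), the new discrepancies cost a|T| + c∫_T |S ∩ B_R(x)|, and
the shrinking of free volume gains c∫_S |T ∩ B_R(x)|. The two double integrals are equal, so only aF
remains. -/
theorem integral_addFree_sub_le {R a c L : ℝ} (hc : 0 ≤ c) (hL : 0 ≤ L) {Λ A : Set α}
    (hΛfin : volume Λ ≠ ⊤) (hA : MeasurableSet A) (hAΛ : A ⊆ Λ) {v : α} (hvA : v ∈ A)
    {g : PointConfig α → ℝ} (hg : FreeLipschitz R a c A L g) (X : PointConfig α) :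
    ∫ x in Λ, |g (addFree R A (X.add v) x) - g (addFree R A X x)|
      ≤ L * (volume.real Λ * (a + c * freeVol R A v X) + a * freeVol R A v X) := by
  have hAfin : volume A ≠ ⊤ := measure_ne_top_of_subset hAΛ hΛfin
  have : IsFiniteMeasure (volume.restrict Λ) := ⟨by simpa using hΛfin.lt_top⟩
  set S := freeSet R A X with hS
  set T := S ∩ Metric.ball v R with hT
  have hSm : MeasurableSet S := measurableSet_freeSet R hA X
  have hTm : MeasurableSet T := hSm.inter Metric.isOpen_ball.measurableSet
  have hSA : S ⊆ A := freeSet_subset R A X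
  have : IsFiniteMeasure (volume.restrict S) :=
    ⟨by simpa using (measure_ne_top_of_subset hSA hAfin).lt_top⟩
  have : IsFiniteMeasure (volume.restrict T) :=
    ⟨by simpa using (measure_ne_top_of_subset (Set.inter_subset_left.trans hSA) hAfin).lt_top⟩
  set W := {p : α × α | dist p.2 p.1 < R} with hWdef
  have hW : MeasurableSet W := measurableSet_lt (measurable_snd.dist measurable_fst) measurable_const
  have hWball : ∀ x, {y | (x, y) ∈ W} = Metric.ball x R := fun x => rfl
  have hf1 : ∀ x, a + c * freeVol R A x X = a + c * (volume.restrict S).real {y | (x, y) ∈ W} := by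
    intro x
    rw [hWball, measureReal_restrict_apply Metric.isOpen_ball.measurableSet, Set.inter_comm]
    rfl
  have hf2 : ∀ x, volume.real (T ∩ Metric.ball x R) = (volume.restrict T).real {y | (x, y) ∈ W} := by
    intro x
    rw [hWball, measureReal_restrict_apply Metric.isOpen_ball.measurableSet, Set.inter_comm]
  have hi1 : IntegrableOn (fun x => a + c * (volume.restrict S).real {y | (x, y) ∈ W}) T :=
    (integrable_const _).add ((integrable_measureReal_prodMk_left _ _ hW).const_mul c)
  have hi2 : IntegrableOn (fun x => (volume.restrict T).real {y | (x, y) ∈ W}) S :=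
    integrable_measureReal_prodMk_left _ _ hW
  have hi1' := ((integrable_indicator_iff hTm).2 hi1).integrableOn (s := Λ)
  have hi2' := ((integrable_indicator_iff hSm).2 hi2).integrableOn (s := Λ)
  -- Symmetry of the relation dist < R, which produces the cancellation.
  have hswap : ∫ x in S, (volume.restrict T).real {y | (x, y) ∈ W}
      = ∫ y in T, (volume.restrict S).real {x | (y, x) ∈ W} := by
    rw [integral_measureReal_prodMk_swap _ _ hW]
    simp only [hWdef, Set.mem_ofPred_eq, dist_comm]
  have hpt := abs_addFree_sub_le hc hL hAfin hvA hg X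
  simp_rw [← hS, ← hT, hf2] at hpt
  simp_rw [hf1] at hpt
  have hint : IntegrableOn (fun x => L * ((a + c * (volume.restrict S).real {y | (v, y) ∈ W}) +
        T.indicator (fun x => a + c * (volume.restrict S).real {y | (x, y) ∈ W}) x -
        c * S.indicator (fun x => (volume.restrict T).real {y | (x, y) ∈ W}) x)) Λ :=
    (((integrable_const _).add hi1').sub (hi2'.const_mul c)).const_mul L
  refine (integral_mono_of_nonneg (Filter.Eventually.of_forall fun x => abs_nonneg _)
    hint (Filter.Eventually.of_forall hpt)).trans (le_of_eq ?_)
  set K := a + c * (volume.restrict S).real {y | (v, y) ∈ W}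
  rw [integral_const_mul, integral_sub (f := fun x => K + T.indicator
      (fun x => a + c * (volume.restrict S).real {y | (x, y) ∈ W}) x)
      ((integrable_const _).add hi1') (hi2'.const_mul c),
    integral_add (integrable_const _) hi1', integral_const_mul, setIntegral_indicator hTm,
    setIntegral_indicator hSm, Set.inter_eq_right.2 (hSA.trans hAΛ),
    Set.inter_eq_right.2 (Set.inter_subset_left.trans (hSA.trans hAΛ)), hswap,
    integral_add (integrable_const _) ((integrable_measureReal_prodMk_left _ _ hW).const_mul c),
    integral_const_mul, integral_const, integral_const, measureReal_restrict_apply_univ,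
    measureReal_restrict_apply_univ]
  simp only [smul_eq_mul]
  have hF : freeVol R A v X = volume.real T := rfl
  rw [hf1, hF]
  ring

theorem integrableOn_deleteBall {r : ℝ} {Λ : Set α} (hΛfin : volume Λ ≠ ⊤)
    {g : PointConfig α → ℝ} (hg : Measurable g) {M : ℝ} (hM : ∀ X, |g X| ≤ M)
    (X : PointConfig α) : IntegrableOn (fun x => g (X.deleteBall r x)) Λ := by
  have : IsFiniteMeasure (volume.restrict Λ) := ⟨by simpa using hΛfin.lt_top⟩
  exact Integrable.of_bound ((hg.comp (measurable_deleteBall r)).comp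
    measurable_prodMk_left).aestronglyMeasurable M (Filter.Eventually.of_forall fun x => hM _)

theorem integrableOn_addFree {R : ℝ} {Λ A : Set α} (hΛfin : volume Λ ≠ ⊤) (hA : MeasurableSet A)
    {g : PointConfig α → ℝ} (hg : Measurable g) {M : ℝ} (hM : ∀ X, |g X| ≤ M)
    (X : PointConfig α) : IntegrableOn (fun x => g (addFree R A X x)) Λ := by
  have : IsFiniteMeasure (volume.restrict Λ) := ⟨by simpa using hΛfin.lt_top⟩
  exact Integrable.of_bound ((hg.comp (measurable_addFree R hA)).comp
    measurable_prodMk_left).aestronglyMeasurable M (Filter.Eventually.of_forall fun x => hM _)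

/-- The deletion and insertion estimates add up to |Λ|(1 + λ)(a + cF) plus the drift bounded in
`hdrift`. -/
theorem FreeLipschitz.stepOp {r a c D L lam δ M : ℝ} (hc : 0 ≤ c) (hL : 0 ≤ L)
    (hlam : 0 ≤ lam) (hδ : 0 ≤ δ) {Λ A : Set α}
    (hΛ : MeasurableSet Λ) (hΛfin : volume Λ ≠ ⊤) (hΛpos : 0 < volume.real Λ)
    (hA : MeasurableSet A) (hAΛ : ∀ v ∈ A, Metric.ball v r ⊆ Λ) (hr : 0 < r)
    (hball : ∀ x : α, volume (Metric.ball x r) = 1)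
    (hD : ∀ x : α, volume (Metric.ball x (2 * r)) = ENNReal.ofReal D) (hD0 : 0 ≤ D)
    (hacD : a + c * D ≤ 1)
    (hdrift : ∀ F, 0 ≤ F → F ≤ D → - a - 2 * c * F + c * D + lam * a * F ≤ - δ)
    {g : PointConfig α → ℝ} (hg : FreeLipschitz (2 * r) a c A L g) (hgm : Measurable g)
    (hM : ∀ X, |g X| ≤ M) :
    FreeLipschitz (2 * r) a c A (L * (1 - δ / (volume.real Λ * (1 + lam))))
      (stepOp r lam Λ A g) := by
  intro X v hv
  have hAΛ' : A ⊆ Λ := fun v hv => hAΛ v hv (Metric.mem_ball_self hr)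
  set N := volume.real Λ with hN
  set F := freeVol (2 * r) A v X with hF
  have hDv : volume.real (Metric.ball v (2 * r)) = D := by
    rw [measureReal_def, hD, ENNReal.toReal_ofReal hD0]
  have hDfin : volume (Metric.ball v (2 * r)) ≠ ⊤ := by
    rw [hD]; exact ENNReal.ofReal_ne_top
  have hF0 : 0 ≤ F := measureReal_nonneg
  have hFD : F ≤ D := by
    rw [← hDv]
    exact measureReal_mono Set.inter_subset_right hDfin
  have h1 := integral_deleteBall_sub_le hc hL hΛ hΛfin hA hAΛ' hball hv (hAΛ v hv) hDv.le hDfin hg X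
  have h2 := integral_addFree_sub_le hc hL hΛfin hA hAΛ' hv hg X
  have h1' := (abs_integral_le_integral_abs (μ := volume.restrict Λ)).trans h1
  have h2' := (abs_integral_le_integral_abs (μ := volume.restrict Λ)).trans h2
  rw [integral_sub (integrableOn_deleteBall hΛfin hgm hM _)
    (integrableOn_deleteBall hΛfin hgm hM _)] at h1'
  rw [integral_sub (integrableOn_addFree hΛfin hA hgm hM _)
    (integrableOn_addFree hΛfin hA hgm hM _)] at h2'
  have hpos : 0 < N * (1 + lam) := by positivity
  rw [HardSphere.stepOp, HardSphere.stepOp, ← mul_sub, abs_mul, abs_of_pos (inv_pos.2 hpos),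
    inv_mul_le_iff₀ hpos]
  have h3 : N * (1 + lam) * (L * (1 - δ / (N * (1 + lam))) * (a + c * F))
      = L * ((N * (1 + lam)) * (a + c * F) - δ * (a + c * F)) := by
    field_simp
  rw [h3, add_sub_add_comm, ← mul_sub]
  refine (abs_add_le _ _).trans ?_
  rw [abs_mul, abs_of_nonneg hlam]
  refine (add_le_add h1' (mul_le_mul_of_nonneg_left h2' hlam)).trans ?_
  -- The weight is at most 1, so the additive drift -δ yields a multiplicative contraction.
  have h4 : δ * (a + c * F) ≤ δ := by
    refine mul_le_of_le_one_right hδ ?_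
    nlinarith
  calc _ = L * ((N - 1) * (a + c * F) + c * (D - F) + lam * (N * (a + c * F) + a * F)) := by ring
    _ ≤ _ := by
      refine mul_le_mul_of_nonneg_left ?_ hL
      have := hdrift F hF0 hFD
      linarith

variable [SFinite (volume : Measure α)]

theorem measurable_stepOp (r lam : ℝ) {Λ A : Set α} (hA : MeasurableSet A)
    {g : PointConfig α → ℝ} (hg : Measurable g) : Measurable (stepOp r lam Λ A g) := by
  have h1 := ((hg.comp (measurable_deleteBall r)).stronglyMeasurable.integral_prod_right'
    (ν := volume.restrict Λ)).measurable
  have h2 := ((hg.comp (measurable_addFree (2 * r) hA)).stronglyMeasurable.integral_prod_right'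
    (ν := volume.restrict Λ)).measurable
  exact (h1.add (h2.const_mul lam)).const_mul _

omit [BorelSpace α] [SecondCountableTopology α] [SFinite (volume : Measure α)] in
theorem abs_stepOp_le {r lam : ℝ} (hlam : 0 ≤ lam) {Λ A : Set α} (hΛfin : volume Λ ≠ ⊤)
    (hΛpos : 0 < volume.real Λ) {g : PointConfig α → ℝ} {M : ℝ} (hM : ∀ X, |g X| ≤ M)
    (X : PointConfig α) : |stepOp r lam Λ A g X| ≤ M := by
  have key : ∀ f : α → PointConfig α, |∫ x in Λ, g (f x)| ≤ M * volume.real Λ := fun f =>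
    by
    rw [← Real.norm_eq_abs]
    exact norm_setIntegral_le_of_norm_le_const hΛfin.lt_top fun x _ => hM (f x)
  have hpos : 0 < volume.real Λ * (1 + lam) := by positivity
  rw [stepOp, abs_mul, abs_of_pos (inv_pos.2 hpos), inv_mul_le_iff₀ hpos]
  refine (abs_add_le _ _).trans ?_
  rw [abs_mul, abs_of_nonneg hlam]
  have h1 := key fun x => X.deleteBall r x
  have h2 := mul_le_mul_of_nonneg_left (key fun x => addFree (2 * r) A X x) hlam
  linarith

omit [BorelSpace α] [SecondCountableTopology α] [SFinite (volume : Measure α)] in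
-- Telescoping: the points of X are added to the empty configuration one at a time, each at weight
-- at most 1.
theorem FreeLipschitz.abs_sub_empty_le {R a c A L} {g : PointConfig α → ℝ} (hL : 0 ≤ L)
    (h1 : ∀ v X, a + c * freeVol R A v X ≤ 1) (hg : FreeLipschitz R a c A L g)
    (X : PointConfig α) (hX : ∀ x ∈ X.points, x ∈ A) :
    |g X - g ⟨∅⟩| ≤ X.points.card * L := by
  classical
  obtain ⟨s⟩ := X
  induction s using Finset.induction_on with
  | empty => simp
  | insert x s hx ih =>
    have h2 := hg ⟨s⟩ x (hX x (Finset.mem_insert_self x s))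
    have h3 := ih fun y hy => hX y (Finset.mem_insert_of_mem hy)
    have h4 : (⟨insert x s⟩ : PointConfig α) = (⟨s⟩ : PointConfig α).add x := by
      ext y; simp [PointConfig.mem_add]
    have h5 := mul_le_mul_of_nonneg_left (h1 x ⟨s⟩) hL
    simp only [h4, Finset.card_insert_of_notMem hx]
    have h6 := abs_sub_le (g ((⟨s⟩ : PointConfig α).add x)) (g ⟨s⟩) (g ⟨∅⟩)
    push_cast
    simp only at h3
    linarith

end Contraction

end HardSphere

/-! ### The Mecke formula for a fixed number of independent points. -/

namespace MeasureTheory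

theorem lintegral_pi_removeNth {α : Type*} [MeasurableSpace α] (ν : Measure α) [SigmaFinite ν]
    {k : ℕ} (i : Fin (k + 1)) {V : α × (Fin k → α) → ℝ≥0∞} (hV : Measurable V) :
    ∫⁻ x, V (x i, i.removeNth x) ∂(Measure.pi fun _ : Fin (k + 1) => ν)
      = ∫⁻ x, ∫⁻ w, V (w, x) ∂ν ∂(Measure.pi fun _ : Fin k => ν) := by
  rw [← lintegral_prod_symm' _ hV,
    ← (measurePreserving_piFinSuccAbove (fun _ => ν) i).lintegral_comp hV]
  rfl

/-- Needed because `ofTuple` forgets repetitions: almost surely a k-tuple yields exactly k points.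
-/
theorem ae_pi_injective {α : Type*} [MeasurableSpace α] [MeasurableEq α] (ν : Measure α)
    [SigmaFinite ν] [NullSingletonClass ν] (k : ℕ) :
    ∀ᵐ x ∂(Measure.pi fun _ : Fin k => ν), Function.Injective x := by
  rcases k with _ | k
  · exact Filter.Eventually.of_forall fun x => Function.injective_of_subsingleton x
  have key : ∀ i j : Fin (k + 1), i ≠ j →
      ∀ᵐ x ∂(Measure.pi fun _ : Fin (k + 1) => ν), x i ≠ x j := by
    intro i j hij
    obtain ⟨j', rfl⟩ := Fin.exists_succAbove_eq hij.symm
    have hs : MeasurableSet {p : α × (Fin k → α) | p.1 = p.2 j'} :=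
      measurableSet_eq_fun measurable_fst ((measurable_pi_apply j').comp measurable_snd)
    have h0 : (ν.prod (Measure.pi fun _ : Fin k => ν)) {p | p.1 = p.2 j'} = 0 := by
      rw [Measure.prod_apply_symm hs, lintegral_eq_zero_iff (measurable_measure_prodMk_right hs)]
      refine Filter.Eventually.of_forall fun y => ?_
      have : (fun x => (x, y)) ⁻¹' {p : α × (Fin k → α) | p.1 = p.2 j'} = {y j'} := by
        ext x; simp
      simp [this]
    exact (measurePreserving_piFinSuccAbove (fun _ => ν) i).quasiMeasurePreserving.ae
      (measure_eq_zero_iff_ae_notMem.1 h0)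
  have key' : ∀ᵐ x ∂(Measure.pi fun _ : Fin (k + 1) => ν), ∀ i j, i ≠ j → x i ≠ x j :=
    ae_all_iff.2 fun i => ae_all_iff.2 fun j => by
      by_cases hij : i = j
      · simp [hij]
      · simpa [hij] using key i j hij
  filter_upwards [key'] with x hx i j hij
  by_contra h
  exact hx i j h hij

end MeasureTheory

namespace PointConfig

variable {α : Type*}

open Classical in
/-- The configuration with the point `x` removed. -/
noncomputable def erase (X : PointConfig α) (x : α) : PointConfig α :=
  ⟨X.points.erase x⟩

theorem mem_erase {X : PointConfig α} {x y : α} : y ∈ (X.erase x).points ↔ y ≠ x ∧ y ∈ X.points := by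
  classical
  simp [erase]

theorem erase_add {X : PointConfig α} {x : α} (hx : x ∈ X.points) : (X.erase x).add x = X := by
  ext y
  simp only [mem_add, mem_erase]
  by_cases h : y = x
  · simp [h, hx]
  · simp [h]

theorem mem_ofTuple {k : ℕ} {x : Fin k → α} {y : α} : y ∈ (ofTuple x).points ↔ ∃ i, x i = y := by
  classical
  simp [ofTuple]

theorem ofTuple_erase {k : ℕ} {x : Fin (k + 1) → α} (hx : Function.Injective x) (i : Fin (k + 1)) :
    (ofTuple x).erase (x i) = ofTuple (i.removeNth x) := by
  ext y
  simp only [mem_erase, mem_ofTuple, Fin.removeNth_apply]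
  constructor
  · rintro ⟨h, j, rfl⟩
    obtain ⟨j', rfl⟩ := Fin.exists_succAbove_eq fun h' : j = i => h (h' ▸ rfl)
    exact ⟨j', rfl⟩
  · rintro ⟨j, rfl⟩
    exact ⟨fun h => Fin.succAbove_ne i j (hx h), _, rfl⟩

theorem sum_ofTuple {k : ℕ} {x : Fin k → α} (hx : Function.Injective x) (f : α → ℝ≥0∞) :
    ∑ w ∈ (ofTuple x).points, f w = ∑ i, f (x i) := by
  classical
  rw [ofTuple, Finset.sum_image fun i _ j _ h => hx h]

/-- The Mecke formula for a fixed number of points. -/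
theorem lintegral_ofTuple_succ [MeasurableSpace α] [MeasurableEq α] (ν : Measure α)
    [SigmaFinite ν] [NullSingletonClass ν] {M : PointConfig α → ℝ≥0∞} {U : PointConfig α × α → ℝ≥0∞}
    (hU : Measurable U) (hM : ∀ X, M X = ∑ w ∈ X.points, U (X.erase w, w)) (k : ℕ) :
    ∫⁻ x, M (ofTuple x) ∂(Measure.pi fun _ : Fin (k + 1) => ν)
      = (k + 1) * ∫⁻ x, ∫⁻ w, U (ofTuple x, w) ∂ν ∂(Measure.pi fun _ : Fin k => ν) := by
  -- For distinct coordinates the sum over points is a sum over indices. Its k + 1 terms then have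
  -- equal integrals, which gives the factor k + 1.
  have h1 : ∀ᵐ x ∂(Measure.pi fun _ : Fin (k + 1) => ν),
      M (ofTuple x) = ∑ i, U (ofTuple (i.removeNth x), x i) := by
    filter_upwards [ae_pi_injective ν (k + 1)] with x hx
    rw [hM, sum_ofTuple hx fun w => U ((ofTuple x).erase w, w)]
    exact Finset.sum_congr rfl fun i _ => by rw [ofTuple_erase hx]
  have hV : Measurable fun p : α × (Fin k → α) => U (ofTuple p.2, p.1) :=
    hU.comp (((measurable_ofTuple k).comp measurable_snd).prodMk measurable_fst)
  have hm : ∀ i : Fin (k + 1),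
      Measurable fun x : Fin (k + 1) → α => U (ofTuple (i.removeNth x), x i) := fun i =>
    hV.comp (f := fun x : Fin (k + 1) → α => (x i, i.removeNth x))
      ((measurable_pi_apply i).prodMk
        (measurable_pi_lambda _ fun j => measurable_pi_apply (i.succAbove j)))
  rw [lintegral_congr_ae h1, lintegral_finsetSum _ fun i _ => hm i]
  have h2 := fun i : Fin (k + 1) => lintegral_pi_removeNth ν i hV
  simp only at h2
  simp_rw [h2]
  simp

end PointConfig

/-! ### Measurability of packings, and the Poisson process. -/

namespace HardSphere

open PointConfig

variable {d : ℕ}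

/-- The σ-algebra only knows counts. The pairs x ≠ y with dist x y < 2r form an open set, so a
violation is witnessed by two sets of a countable basis, both meeting X, whose product lies in that
open set. -/
theorem measurableSet_packings (r : ℝ) : MeasurableSet (packings d r) := by
  set b := TopologicalSpace.countableBasis (EuclideanSpace ℝ (Fin d)) with hb
  have hbasis := TopologicalSpace.isBasis_countableBasis (EuclideanSpace ℝ (Fin d))
  have h : (packings d r)ᶜ = ⋃ u ∈ b, ⋃ v ∈ b,
      {X | (∀ x ∈ u, ∀ y ∈ v, x ≠ y ∧ dist x y < 2 * r) ∧ count u X ≠ 0 ∧ count v X ≠ 0} := by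
    have hcount : ∀ (B : Set (EuclideanSpace ℝ (Fin d))) X, count B X ≠ 0 ↔
        ∃ x ∈ X.points, x ∈ B := by
      intro B X
      simp [count_eq_sum]
    ext X
    simp only [packings, Set.mem_compl_iff, Set.mem_ofPred_eq, Set.mem_iUnion, hcount]
    constructor
    · intro hX
      push Not at hX
      obtain ⟨x, hx, y, hy, hne, hxy⟩ := hX
      have ho : IsOpen {p : EuclideanSpace ℝ (Fin d) × EuclideanSpace ℝ (Fin d) |
          p.1 ≠ p.2 ∧ dist p.1 p.2 < 2 * r} :=
        (isOpen_ne_fun continuous_fst continuous_snd).inter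
          (isOpen_lt (continuous_fst.dist continuous_snd) continuous_const)
      obtain ⟨u', v', hu', hv', hxu, hyv, huv⟩ := isOpen_prod_iff.1 ho x y ⟨hne, hxy⟩
      obtain ⟨u, hu, hxu', huu⟩ := hbasis.exists_subset_of_mem_open hxu hu'
      obtain ⟨v, hv, hyv', hvv⟩ := hbasis.exists_subset_of_mem_open hyv hv'
      exact ⟨u, hu, v, hv, fun a ha c hc => @huv (a, c) ⟨huu ha, hvv hc⟩,
        ⟨x, hx, hxu'⟩, ⟨y, hy, hyv'⟩⟩
    · rintro ⟨u, -, v, -, huv, ⟨x, hx, hxu⟩, ⟨y, hy, hyv⟩⟩ hX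
      obtain ⟨h1, h2⟩ := huv x hxu y hyv
      exact absurd (hX x hx y hy h1) (not_le.2 h2)
  rw [← MeasurableSet.compl_iff, h]
  have hbc : b.Countable := TopologicalSpace.countable_countableBasis _
  have hm : ∀ u ∈ b, MeasurableSet {X : PointConfig (EuclideanSpace ℝ (Fin d)) | count u X ≠ 0} :=
    fun u hu => measurable_count (hbasis.isOpen hu).measurableSet
      (measurableSet_singleton 0).compl
  refine MeasurableSet.biUnion hbc fun u hu => MeasurableSet.biUnion hbc fun v hv => ?_
  exact (MeasurableSet.const _).inter ((hm u hu).inter (hm v hv))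

theorem measurableSet_configs (r : ℝ) {Λ τ : Set (EuclideanSpace ℝ (Fin d))}
    (hΛ : MeasurableSet Λ) (hτ : MeasurableSet τ) : MeasurableSet (configs r Λ τ) := by
  have h : configs r Λ τ = count (interiorSet r Λ \ τ)ᶜ ⁻¹' {0} ∩ packings d r := by
    ext X
    simp [configs, count_eq_sum]
  rw [h]
  exact (measurable_count ((measurableSet_interiorSet r hΛ).diff hτ).compl
    (measurableSet_singleton 0)).inter (measurableSet_packings r)

section Poisson

variable {lam : ℝ} {S : Set (EuclideanSpace ℝ (Fin d))}

theorem lintegral_poissonProcess {f : PointConfig (EuclideanSpace ℝ (Fin d)) → ℝ≥0∞}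
    (hf : Measurable f) :
    ∫⁻ X, f X ∂(poissonProcess lam S) = ∑' k : ℕ,
      ENNReal.ofReal (Real.exp (-(lam * volume.real S)) * lam ^ k / (k.factorial : ℝ)) *
        ∫⁻ x, f (ofTuple x) ∂(Measure.pi fun _ : Fin k => volume.restrict S) := by
  rw [poissonProcess, lintegral_sum_measure]
  refine tsum_congr fun k => ?_
  rw [lintegral_smul_measure, lintegral_map hf (measurable_ofTuple k), smul_eq_mul]

theorem isFiniteMeasure_poissonProcess (hlam : 0 ≤ lam) (hS : volume S ≠ ⊤) :
    IsFiniteMeasure (poissonProcess lam S) := by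
  refine ⟨?_⟩
  rw [← lintegral_one, lintegral_poissonProcess measurable_const]
  have h : ∀ k : ℕ, ENNReal.ofReal (Real.exp (-(lam * volume.real S)) * lam ^ k /
      (k.factorial : ℝ)) * ∫⁻ _, 1 ∂(Measure.pi fun _ : Fin k => volume.restrict S)
      = ENNReal.ofReal (Real.exp (-(lam * volume.real S)) *
        ((lam * volume.real S) ^ k / (k.factorial : ℝ))) := by
    intro k
    rw [lintegral_one, Measure.pi_univ]
    simp only [Measure.restrict_apply_univ, Finset.prod_const, Finset.card_univ, Fintype.card_fin]
    rw [← ENNReal.ofReal_toReal hS, ← ENNReal.ofReal_pow ENNReal.toReal_nonneg,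
      ← ENNReal.ofReal_mul (by positivity), measureReal_def]
    congr 1
    rw [mul_pow]
    ring
  simp_rw [h]
  exact ((Real.summable_pow_div_factorial _).mul_left _).tsum_ofReal_lt_top

theorem ae_poissonProcess_mem (hS : MeasurableSet S) (hSfin : volume S ≠ ⊤) :
    ∀ᵐ X ∂(poissonProcess lam S), ∀ x ∈ X.points, x ∈ S := by
  have : IsFiniteMeasure (volume.restrict S) := ⟨by simpa using hSfin.lt_top⟩
  have hm : MeasurableSet {X : PointConfig (EuclideanSpace ℝ (Fin d)) | ∀ x ∈ X.points, x ∈ S} := by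
    have := measurableSet_forall_notMem (measurable_fst (β := Unit) hS.compl)
    simpa using (measurable_id.prodMk measurable_const : Measurable fun X :
      PointConfig (EuclideanSpace ℝ (Fin d)) => (X, ())) this
  rw [poissonProcess, Measure.ae_sum_iff' hm]
  intro k
  refine Measure.ae_smul_measure ?_ _
  rw [ae_map_iff (measurable_ofTuple k).aemeasurable hm]
  have h : ∀ i, ∀ᵐ x ∂(Measure.pi fun _ : Fin k => volume.restrict S), x i ∈ S := fun i =>
    Measure.tendsto_eval_ae_ae.eventually (ae_restrict_mem hS)
  filter_upwards [ae_all_iff.2 h] with x hx y hy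
  obtain ⟨i, rfl⟩ := mem_ofTuple.1 hy
  exact hx i

theorem poissonProcess_packings_ne_zero (r : ℝ) :
    poissonProcess lam S (packings d r) ≠ 0 := by
  rw [poissonProcess, Measure.sum_apply _ (measurableSet_packings r)]
  have h : ENNReal.ofReal (Real.exp (-(lam * volume.real S))) ≤
    ∑' k : ℕ, (ENNReal.ofReal (Real.exp (-(lam * volume.real S)) * lam ^ k / (k.factorial : ℝ)) •
      (Measure.pi fun _ : Fin k => volume.restrict S).map ofTuple) (packings d r) := by
    -- The term k = 0 is the empty configuration, which is always a packing.
    refine le_trans (le_of_eq ?_) (ENNReal.le_tsum 0)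
    have : ofTuple ⁻¹' packings d r
        = (Set.univ : Set (Fin 0 → EuclideanSpace ℝ (Fin d))) := by
      ext x
      simp [packings, mem_ofTuple]
    rw [Measure.smul_apply, Measure.map_apply (measurable_ofTuple 0) (measurableSet_packings r),
      this, Measure.pi_univ]
    simp
  exact ((ENNReal.ofReal_pos.2 (Real.exp_pos _)).trans_le h).ne'

/-- The Mecke formula for the Poisson point process. -/
theorem lintegral_poissonProcess_mecke [NeZero d] (hlam : 0 ≤ lam) (hSfin : volume S ≠ ⊤)
    {M : PointConfig (EuclideanSpace ℝ (Fin d)) → ℝ≥0∞}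
    {U : PointConfig (EuclideanSpace ℝ (Fin d)) × EuclideanSpace ℝ (Fin d) → ℝ≥0∞}
    (hMm : Measurable M) (hU : Measurable U)
    (hM : ∀ X, M X = ∑ w ∈ X.points, U (X.erase w, w)) :
    ∫⁻ X, M X ∂(poissonProcess lam S) =
      ENNReal.ofReal lam * ∫⁻ X, (∫⁻ w in S, U (X, w)) ∂(poissonProcess lam S) := by
  have : IsFiniteMeasure (volume.restrict S) := ⟨by simpa using hSfin.lt_top⟩
  rw [lintegral_poissonProcess hMm, lintegral_poissonProcess hU.lintegral_prod_right',
    tsum_eq_zero_add' ENNReal.summable, ← ENNReal.tsum_mul_left]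
  -- The k = 0 term vanishes. After the shift the weights match because (k + 1)λ^{k+1}/(k + 1)! = λ
  -- · λ^k/k!.
  have h0 : ∀ x : Fin 0 → EuclideanSpace ℝ (Fin d), M (ofTuple x) = 0 := by
    intro x
    rw [hM]
    refine Finset.sum_eq_zero fun w hw => ?_
    obtain ⟨i, -⟩ := mem_ofTuple.1 hw
    exact i.elim0
  simp_rw [h0]
  rw [lintegral_zero, mul_zero, zero_add]
  refine tsum_congr fun k => ?_
  rw [lintegral_ofTuple_succ (volume.restrict S) hU hM, ← mul_assoc, ← mul_assoc,
    ← ENNReal.ofReal_mul hlam]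
  congr 1
  have : ((k : ℝ≥0∞) + 1) = ENNReal.ofReal (k + 1) := by
    rw [ENNReal.ofReal_add (by positivity) zero_le_one]
    simp
  rw [this, ← ENNReal.ofReal_mul (by positivity)]
  congr 1
  rw [Nat.factorial_succ]
  push_cast
  field_simp
  ring

end Poisson

end HardSphere

/-! ### Balance of insertions and deletions under the Poisson law. -/

namespace HardSphere

open PointConfig

variable {d : ℕ} {r : ℝ} {Λ τ : Set (EuclideanSpace ℝ (Fin d))}

theorem ball_subset_of_mem_interiorSet {v : EuclideanSpace ℝ (Fin d)} (hv : v ∈ interiorSet r Λ) :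
    Metric.ball v r ⊆ Λ := by
  intro y hy
  by_contra hyΛ
  have h1 : ENNReal.ofReal r ≤ edist v y := hv.2.trans (Metric.infEDist_le_edist_of_mem hyΛ)
  rw [edist_dist, dist_comm] at h1
  have h2 := Metric.mem_ball.1 hy
  exact absurd ((ENNReal.ofReal_le_ofReal_iff dist_nonneg).1 h1) (not_le.2 h2)

/-- A point already in X is not free, yet adding it changes nothing. This exception is harmless for
`addFree` and null under integration. -/
theorem add_mem_configs_iff {X : PointConfig (EuclideanSpace ℝ (Fin d))} (hX : X ∈ configs r Λ τ)
    (x : EuclideanSpace ℝ (Fin d)) : X.add x ∈ configs r Λ τ ↔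
      x ∈ X.points ∨ x ∈ freeSet (2 * r) (interiorSet r Λ \ τ) X := by
  constructor
  · intro h
    by_cases hx : x ∈ X.points
    · exact Or.inl hx
    · exact Or.inr ⟨h.1 x (mem_add.2 (Or.inl rfl)), fun y hy => h.2 y (mem_add.2 (Or.inr hy)) x
        (mem_add.2 (Or.inl rfl)) fun h' => hx (h' ▸ hy)⟩
  · rintro (hx | hx)
    · rwa [add_of_mem hx]
    · refine ⟨fun y hy => ?_, fun y hy z hz hyz => ?_⟩
      · rcases mem_add.1 hy with rfl | hy
        exacts [hx.1, hX.1 y hy]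
      · rcases mem_add.1 hy with hy' | hy' <;> rcases mem_add.1 hz with hz' | hz'
        · exact absurd (hy'.trans hz'.symm) hyz
        · rw [hy', dist_comm]; exact hx.2 z hz'
        · rw [hz']; exact hx.2 y hy'
        · exact hX.2 y hy' z hz' hyz

theorem mem_configs_of_add_mem {X : PointConfig (EuclideanSpace ℝ (Fin d))}
    {x : EuclideanSpace ℝ (Fin d)} (h : X.add x ∈ configs r Λ τ) : X ∈ configs r Λ τ :=
  ⟨fun y hy => h.1 y (mem_add.2 (Or.inr hy)),
    fun y hy z hz => h.2 y (mem_add.2 (Or.inr hy)) z (mem_add.2 (Or.inr hz))⟩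

theorem coe_addStep (X : configs r Λ τ) (x : EuclideanSpace ℝ (Fin d)) :
    (addStep X x).1 = addFree (2 * r) (interiorSet r Λ \ τ) X.1 x := by
  by_cases hx : x ∈ freeSet (2 * r) (interiorSet r Λ \ τ) X.1
  · rw [addStep, dif_pos ((add_mem_configs_iff X.2 x).2 (Or.inr hx)), addFree, if_pos hx]
  · rw [addFree, if_neg hx]
    by_cases h : X.1.add x ∈ configs r Λ τ
    · rw [addStep, dif_pos h]
      exact add_of_mem (((add_mem_configs_iff X.2 x).1 h).resolve_right hx)
    · rw [addStep, dif_neg h]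

/-- The set of points at distance less than `r` from some point of `X`. -/
def nearSet (r : ℝ) (X : PointConfig (EuclideanSpace ℝ (Fin d))) :
    Set (EuclideanSpace ℝ (Fin d)) :=
  ⋃ w ∈ X.points, Metric.ball w r

theorem mem_nearSet {X : PointConfig (EuclideanSpace ℝ (Fin d))} {x : EuclideanSpace ℝ (Fin d)} :
    x ∈ nearSet r X ↔ ∃ w ∈ X.points, dist x w < r := by
  simp [nearSet]

theorem measurableSet_nearSet (X : PointConfig (EuclideanSpace ℝ (Fin d))) :
    MeasurableSet (nearSet r X) :=
  X.points.measurableSet_biUnion fun _ _ => Metric.isOpen_ball.measurableSet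

theorem nearSet_subset {X : PointConfig (EuclideanSpace ℝ (Fin d))} (hX : X ∈ configs r Λ τ) :
    nearSet r X ⊆ Λ :=
  Set.iUnion₂_subset fun w hw => ball_subset_of_mem_interiorSet (hX.1 w hw).1

theorem pairwiseDisjoint_ball {X : PointConfig (EuclideanSpace ℝ (Fin d))}
    (hX : X ∈ configs r Λ τ) :
    Set.PairwiseDisjoint (X.points : Set (EuclideanSpace ℝ (Fin d))) fun w => Metric.ball w r :=
  fun x hx y hy hxy => Metric.ball_disjoint_ball (by
    have := hX.2 x hx y hy hxy
    linarith)

/-- Centers are 2r apart, so an open r-ball contains at most one of them. -/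
theorem deleteBall_eq_erase {X : PointConfig (EuclideanSpace ℝ (Fin d))} (hX : X ∈ configs r Λ τ)
    {w x : EuclideanSpace ℝ (Fin d)} (hw : w ∈ X.points) (hx : x ∈ Metric.ball w r) :
    X.deleteBall r x = X.erase w := by
  ext y
  rw [mem_deleteBall, mem_erase]
  rw [Metric.mem_ball, dist_comm] at hx
  constructor
  · rintro ⟨h1, h2⟩
    exact ⟨fun h => absurd h2 (h ▸ not_le.2 hx), h1⟩
  · rintro ⟨h1, h2⟩
    refine ⟨h2, ?_⟩
    have h3 := hX.2 y h2 w hw h1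
    have h4 := dist_triangle_right y w x
    linarith

theorem deleteBall_eq_self {X : PointConfig (EuclideanSpace ℝ (Fin d))}
    {x : EuclideanSpace ℝ (Fin d)} (hx : x ∉ nearSet r X) : X.deleteBall r x = X := by
  ext y
  rw [mem_deleteBall]
  refine ⟨fun h => h.1, fun h => ⟨h, ?_⟩⟩
  by_contra h'
  rw [not_le, dist_comm] at h'
  exact hx (mem_nearSet.2 ⟨y, h, h'⟩)

section

variable (hball : ∀ x : EuclideanSpace ℝ (Fin d), volume (Metric.ball x r) = 1)
include hball

theorem lintegral_nearSet_deleteBall {X : PointConfig (EuclideanSpace ℝ (Fin d))}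
    (hX : X ∈ configs r Λ τ) (h : PointConfig (EuclideanSpace ℝ (Fin d)) → ℝ≥0∞) :
    ∫⁻ x in nearSet r X, h (X.deleteBall r x) = ∑ w ∈ X.points, h (X.erase w) := by
  rw [nearSet, lintegral_biUnion_finset (pairwiseDisjoint_ball hX)
    fun w _ => Metric.isOpen_ball.measurableSet]
  refine Finset.sum_congr rfl fun w hw => ?_
  rw [setLIntegral_congr_fun Metric.isOpen_ball.measurableSet
    (fun x hx => by rw [deleteBall_eq_erase hX hw hx] : Set.EqOn _ (fun _ => h (X.erase w)) _),
    setLIntegral_const, hball, mul_one]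

theorem volume_nearSet {X : PointConfig (EuclideanSpace ℝ (Fin d))} (hX : X ∈ configs r Λ τ) :
    volume (nearSet r X) = X.points.card := by
  rw [nearSet, measure_biUnion_finset (pairwiseDisjoint_ball hX)
    fun w _ => Metric.isOpen_ball.measurableSet]
  simp [hball]

theorem card_points_le {X : PointConfig (EuclideanSpace ℝ (Fin d))} (hX : X ∈ configs r Λ τ) :
    (X.points.card : ℝ≥0∞) ≤ volume Λ := by
  rw [← volume_nearSet hball hX]
  exact measure_mono (nearSet_subset hX)

/-- Each center w is erased on a set of volume 1, and nothing happens on the remaining volume |Λ| -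
|X|. The identity is stated additively to avoid subtraction in `ℝ≥0∞`. -/
theorem lintegral_deleteBall_add {X : PointConfig (EuclideanSpace ℝ (Fin d))}
    (hX : X ∈ configs r Λ τ) (h : PointConfig (EuclideanSpace ℝ (Fin d)) → ℝ≥0∞) :
    (∫⁻ x in Λ, h (X.deleteBall r x)) + X.points.card * h X
      = ∑ w ∈ X.points, h (X.erase w) + volume Λ * h X := by
  have hm := measurableSet_nearSet (r := r) X
  have h1 : ∫⁻ x in Λ \ nearSet r X, h (X.deleteBall r x) = h X * volume (Λ \ nearSet r X) := by
    rw [← setLIntegral_const]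
    refine lintegral_congr_ae ?_
    have h0 : ∀ᵐ x ∂(volume.restrict (Λ \ nearSet r X)), x ∉ nearSet r X :=
      measure_eq_zero_iff_ae_notMem.1 (by rw [Measure.restrict_apply hm]; simp)
    filter_upwards [h0] with x hx
    rw [deleteBall_eq_self hx]
  rw [← lintegral_inter_add_sdiff _ Λ hm, Set.inter_eq_right.2 (nearSet_subset hX), h1,
    lintegral_nearSet_deleteBall hball hX, ← volume_nearSet hball hX,
    ← measure_inter_add_sdiff Λ hm, Set.inter_eq_right.2 (nearSet_subset hX)]
  ring

end

theorem lintegral_addFree_add (hΛ : MeasurableSet Λ) (hτ : MeasurableSet τ)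
    (X : PointConfig (EuclideanSpace ℝ (Fin d)))
    (h : PointConfig (EuclideanSpace ℝ (Fin d)) → ℝ≥0∞) :
    (∫⁻ x in Λ, h (addFree (2 * r) (interiorSet r Λ \ τ) X x)) +
        volume (freeSet (2 * r) (interiorSet r Λ \ τ) X) * h X
      = (∫⁻ x in freeSet (2 * r) (interiorSet r Λ \ τ) X, h (X.add x)) + volume Λ * h X := by
  set A := interiorSet r Λ \ τ
  have hA : MeasurableSet A := (measurableSet_interiorSet r hΛ).diff hτ
  have hAΛ : A ⊆ Λ := fun x hx => hx.1.1
  have hm := measurableSet_freeSet (2 * r) hA X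
  have hsub := (freeSet_subset (2 * r) A X).trans hAΛ
  rw [← lintegral_inter_add_sdiff _ Λ hm, Set.inter_eq_right.2 hsub,
    ← measure_inter_add_sdiff Λ hm, Set.inter_eq_right.2 hsub,
    setLIntegral_congr_fun hm (fun x hx => by rw [addFree, if_pos hx] :
      Set.EqOn _ (fun x => h (X.add x)) _),
    setLIntegral_congr_fun (hΛ.diff hm) (fun x hx => by rw [addFree, if_neg hx.2] :
      Set.EqOn _ (fun _ => h X) _), setLIntegral_const]
  ring

theorem lintegral_indicator_add_mem_configs [NeZero d] (hΛ : MeasurableSet Λ)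
    (hτ : MeasurableSet τ) (X : PointConfig (EuclideanSpace ℝ (Fin d)))
    (G : EuclideanSpace ℝ (Fin d) → ℝ≥0∞) :
    ∫⁻ w in interiorSet r Λ \ τ, {w | X.add w ∈ configs r Λ τ}.indicator G w
      = (configs r Λ τ).indicator
        (fun X => ∫⁻ w in freeSet (2 * r) (interiorSet r Λ \ τ) X, G w) X := by
  classical
  set A := interiorSet r Λ \ τ with hAdef
  have hA : MeasurableSet A := (measurableSet_interiorSet r hΛ).diff hτ
  by_cases hX : X ∈ configs r Λ τ
  · rw [Set.indicator_of_mem hX]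
    have h1 : ∀ᵐ w ∂(volume.restrict A), {w | X.add w ∈ configs r Λ τ}.indicator G w
        = (freeSet (2 * r) A X).indicator G w := by
      have h0 : (volume.restrict A) (X.points : Set (EuclideanSpace ℝ (Fin d))) = 0 :=
        X.points.finite_toSet.measure_zero _
      filter_upwards [measure_eq_zero_iff_ae_notMem.1 h0] with w hw
      have : w ∈ {w | X.add w ∈ configs r Λ τ} ↔ w ∈ freeSet (2 * r) A X :=
        (add_mem_configs_iff hX w).trans (or_iff_right hw)
      simp only [Set.indicator_apply, this]
    rw [lintegral_congr_ae h1, setLIntegral_indicator (measurableSet_freeSet _ hA X),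
      Set.inter_eq_left.2 (freeSet_subset _ A X)]
  · rw [Set.indicator_of_notMem hX]
    have h1 : ∀ w, {w | X.add w ∈ configs r Λ τ}.indicator G w = 0 := fun w =>
      Set.indicator_of_notMem (s := {w | X.add w ∈ configs r Λ τ})
        (fun h => hX (mem_configs_of_add_mem h)) _
    simp_rw [h1]
    simp

/-- This is stationarity tested against h, before normalisation. Mecke turns the inflow into X from
deletions into the outflow by insertions (`e3`), and the outflow by deletions into the inflow from
insertions (`e4`). What remains on each side is the total rate |Λ|(1 + λ). -/
theorem setLIntegral_configs_step [NeZero d] {lam : ℝ} (hlam : 0 ≤ lam)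
    (hball : ∀ x : EuclideanSpace ℝ (Fin d), volume (Metric.ball x r) = 1)
    (hΛ : MeasurableSet Λ) (hΛfin : volume Λ ≠ ⊤) (hτ : MeasurableSet τ)
    {h : PointConfig (EuclideanSpace ℝ (Fin d)) → ℝ≥0∞} (hm : Measurable h) (h1 : ∀ X, h X ≤ 1) :
    (∫⁻ X in configs r Λ τ, (∫⁻ x in Λ, h (X.deleteBall r x))
        ∂(poissonProcess lam (interiorSet r Λ \ τ))) +
      ENNReal.ofReal lam * ∫⁻ X in configs r Λ τ,
        (∫⁻ x in Λ, h (addFree (2 * r) (interiorSet r Λ \ τ) X x))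
          ∂(poissonProcess lam (interiorSet r Λ \ τ))
      = volume Λ * (1 + ENNReal.ofReal lam) *
        ∫⁻ X in configs r Λ τ, h X ∂(poissonProcess lam (interiorSet r Λ \ τ)) := by
  set A := interiorSet r Λ \ τ with hAdef
  have hA : MeasurableSet A := (measurableSet_interiorSet r hΛ).diff hτ
  have hAΛ : A ⊆ Λ := fun x hx => hx.1.1
  have hAfin : volume A ≠ ⊤ := measure_ne_top_of_subset hAΛ hΛfin
  have hC : MeasurableSet (configs r Λ τ) := measurableSet_configs r hΛ hτ
  set P := poissonProcess lam A with hP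
  have : IsFiniteMeasure P := isFiniteMeasure_poissonProcess hlam hAfin
  set C := configs r Λ τ with hCdef
  set l := ENNReal.ofReal lam
  have hdel : Measurable fun X : PointConfig (EuclideanSpace ℝ (Fin d)) =>
      ∫⁻ x in Λ, h (X.deleteBall r x) :=
    (hm.comp (measurable_deleteBall r)).lintegral_prod_right'
  have hadd : Measurable fun X : PointConfig (EuclideanSpace ℝ (Fin d)) =>
      ∫⁻ x in Λ, h (addFree (2 * r) A X x) :=
    (hm.comp (measurable_addFree (2 * r) hA)).lintegral_prod_right'
  have hcard : Measurable fun X : PointConfig (EuclideanSpace ℝ (Fin d)) =>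
      (X.points.card : ℝ≥0∞) := by
    have h2 : (fun X : PointConfig (EuclideanSpace ℝ (Fin d)) => (X.points.card : ℝ≥0∞))
        = fun X => ((count Set.univ X : ℕ) : ℝ≥0∞) := by
      funext X; simp [count]
    rw [h2]
    exact measurable_from_top.comp (measurable_count MeasurableSet.univ)
  have haddC : MeasurableSet {p : PointConfig (EuclideanSpace ℝ (Fin d)) ×
      EuclideanSpace ℝ (Fin d) | p.1.add p.2 ∈ C} := measurable_add hC
  have hnear : MeasurableSet {p : PointConfig (EuclideanSpace ℝ (Fin d)) ×
      EuclideanSpace ℝ (Fin d) | p.2 ∈ nearSet r p.1} := by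
    have hd := (measurableSet_forall_notMem (measurableSet_lt measurable_dist
      (measurable_const (a := r)) : MeasurableSet {q : EuclideanSpace ℝ (Fin d) ×
        EuclideanSpace ℝ (Fin d) | dist q.1 q.2 < r})).compl
    convert hd using 1
    ext p
    simp [mem_nearSet, dist_comm]
  have hR : Measurable fun X : PointConfig (EuclideanSpace ℝ (Fin d)) =>
      ∫⁻ x in nearSet r X, h (X.deleteBall r x) := by
    have := ((hm.comp (measurable_deleteBall r)).indicator hnear).lintegral_prod_right'
      (ν := (volume : Measure (EuclideanSpace ℝ (Fin d))))
    convert this using 2 with X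
    rw [← lintegral_indicator (measurableSet_nearSet X)]
    rfl
  have hE : Measurable fun X : PointConfig (EuclideanSpace ℝ (Fin d)) =>
      ∫⁻ x in freeSet (2 * r) A X, h (X.add x) := by
    have := ((hm.comp measurable_add).indicator
      (measurableSet_mem_freeSet (2 * r) hA)).lintegral_prod_right'
      (ν := (volume : Measure (EuclideanSpace ℝ (Fin d))))
    convert this using 2 with X
    rw [← lintegral_indicator (measurableSet_freeSet (2 * r) hA X)]
    rfl
  have e1 : (∫⁻ X in C, (∫⁻ x in Λ, h (X.deleteBall r x)) ∂P) + ∫⁻ X in C, X.points.card * h X ∂P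
      = (∫⁻ X in C, (∫⁻ x in nearSet r X, h (X.deleteBall r x)) ∂P)
        + volume Λ * ∫⁻ X in C, h X ∂P := by
    rw [← lintegral_const_mul _ hm, ← lintegral_add_left hdel, ← lintegral_add_left hR]
    refine setLIntegral_congr_fun hC fun X hX => ?_
    rw [lintegral_deleteBall_add hball hX, lintegral_nearSet_deleteBall hball hX]
  have e2 : (∫⁻ X in C, (∫⁻ x in Λ, h (addFree (2 * r) A X x)) ∂P) +
        ∫⁻ X in C, volume (freeSet (2 * r) A X) * h X ∂P
      = (∫⁻ X in C, (∫⁻ x in freeSet (2 * r) A X, h (X.add x)) ∂P)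
        + volume Λ * ∫⁻ X in C, h X ∂P := by
    rw [← lintegral_const_mul _ hm, ← lintegral_add_left hadd, ← lintegral_add_left hE]
    exact lintegral_congr fun X => lintegral_addFree_add hΛ hτ X h
  -- Mecke with U(X, w) = h(X) on the event that X + w is a configuration.
  have e3 : ∫⁻ X in C, (∫⁻ x in nearSet r X, h (X.deleteBall r x)) ∂P
      = l * ∫⁻ X in C, volume (freeSet (2 * r) A X) * h X ∂P := by
    have := lintegral_poissonProcess_mecke hlam hAfin (hR.indicator hC)
      ((hm.comp measurable_fst).indicator haddC) fun X => by
        by_cases hX : X ∈ C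
        · rw [Set.indicator_of_mem hX, lintegral_nearSet_deleteBall hball hX]
          refine Finset.sum_congr rfl fun w hw => ?_
          rw [Set.indicator_of_mem]
          · rfl
          · exact (congrArg (· ∈ C) (erase_add hw)).mpr hX
        · rw [Set.indicator_of_notMem hX]
          refine (Finset.sum_eq_zero fun w hw => ?_).symm
          rw [Set.indicator_of_notMem]
          exact fun h' => hX (erase_add hw ▸ h')
    rw [lintegral_indicator hC] at this
    rw [this, ← lintegral_indicator hC]
    congr 1
    refine lintegral_congr fun X => (lintegral_indicator_add_mem_configs hΛ hτ X
      fun _ => h X).trans ?_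
    simp only [setLIntegral_const]
    by_cases hX : X ∈ C
    · rw [Set.indicator_of_mem hX, Set.indicator_of_mem hX, mul_comm]
    · rw [Set.indicator_of_notMem hX, Set.indicator_of_notMem hX]
  -- Mecke with U(X, w) = h(X + w) on the same event.
  have e4 : ∫⁻ X in C, X.points.card * h X ∂P
      = l * ∫⁻ X in C, (∫⁻ x in freeSet (2 * r) A X, h (X.add x)) ∂P := by
    have := lintegral_poissonProcess_mecke hlam hAfin ((hcard.mul hm).indicator hC)
      ((hm.comp measurable_add).indicator haddC) fun X => by
        by_cases hX : X ∈ C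
        · rw [Set.indicator_of_mem hX]
          have h2 : ∀ w ∈ X.points, {p : PointConfig (EuclideanSpace ℝ (Fin d)) ×
              EuclideanSpace ℝ (Fin d) | p.1.add p.2 ∈ C}.indicator
              (h ∘ fun p => p.1.add p.2) (X.erase w, w) = h X := by
            intro w hw
            rw [Set.indicator_of_mem]
            · simp only [Function.comp_apply, erase_add hw]
            · exact (congrArg (· ∈ C) (erase_add hw)).mpr hX
          rw [Finset.sum_congr rfl h2]
          simp
        · rw [Set.indicator_of_notMem hX]
          refine (Finset.sum_eq_zero fun w hw => ?_).symm
          rw [Set.indicator_of_notMem]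
          exact fun h' => hX (erase_add hw ▸ h')
    rw [lintegral_indicator hC] at this
    refine this.trans ?_
    rw [← lintegral_indicator hC]
    congr 1
    exact lintegral_congr fun X => lintegral_indicator_add_mem_configs hΛ hτ X fun w => h (X.add w)
  have f1 : ∫⁻ X in C, X.points.card * h X ∂P ≠ ⊤ := by
    have h2 : ∫⁻ X in C, X.points.card * h X ∂P ≤ ∫⁻ _ in C, volume Λ ∂P :=
      setLIntegral_mono measurable_const fun X hX =>
        (mul_le_mul' (card_points_le hball hX) (h1 X)).trans_eq (mul_one _)
    refine ne_top_of_le_ne_top ?_ h2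
    rw [setLIntegral_const]
    exact ENNReal.mul_ne_top hΛfin (measure_ne_top _ _)
  have f2 : ∫⁻ X in C, volume (freeSet (2 * r) A X) * h X ∂P ≠ ⊤ := by
    have h2 : ∫⁻ X in C, volume (freeSet (2 * r) A X) * h X ∂P ≤ ∫⁻ _ in C, volume Λ ∂P :=
      lintegral_mono fun X => (mul_le_mul' (measure_mono
        ((freeSet_subset (2 * r) A X).trans hAΛ)) (h1 X)).trans_eq (mul_one _)
    refine ne_top_of_le_ne_top ?_ h2
    rw [setLIntegral_const]
    exact ENNReal.mul_ne_top hΛfin (measure_ne_top _ _)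
  -- The outflow terms are finite, since |X| and the free volume are at most |Λ|; hence they may be
  -- cancelled.
  have f3 : (∫⁻ X in C, X.points.card * h X ∂P) +
      l * ∫⁻ X in C, volume (freeSet (2 * r) A X) * h X ∂P ≠ ⊤ :=
    ENNReal.add_ne_top.2 ⟨f1, ENNReal.mul_ne_top ENNReal.ofReal_ne_top f2⟩
  refine (ENNReal.add_left_inj f3).1 ?_
  calc _ = ((∫⁻ X in C, (∫⁻ x in Λ, h (X.deleteBall r x)) ∂P) + ∫⁻ X in C, X.points.card * h X ∂P)
        + l * ((∫⁻ X in C, (∫⁻ x in Λ, h (addFree (2 * r) A X x)) ∂P) +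
        ∫⁻ X in C, volume (freeSet (2 * r) A X) * h X ∂P) := by ring
    _ = _ := by rw [e1, e2, e3, e4]; ring

end HardSphere

/-! ### From the Markov kernel to the operator, and stationarity. -/

theorem integral_bind_kernel {Ω : Type*} [MeasurableSpace Ω] (κ : Kernel Ω Ω) [IsMarkovKernel κ]
    (p : Measure Ω) [IsProbabilityMeasure p] {f : Ω → ℝ} (hf : Measurable f) {M : ℝ}
    (hM : ∀ X, |f X| ≤ M) : ∫ X, f X ∂(p.bind κ) = ∫ X, ∫ Y, f Y ∂(κ X) ∂p := by
  have h := Kernel.integral_comp (κ := Kernel.const Unit p) (η := κ) (a := ()) (f := f)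
    (Integrable.of_bound hf.aestronglyMeasurable M (Filter.Eventually.of_forall hM))
  simpa [Kernel.comp_apply] using h

theorem lawAfter_eq_self {Ω : Type*} [MeasurableSpace Ω] {κ : Kernel Ω Ω} {p : Measure Ω}
    (h : κ.Invariant p) (t : ℕ) : lawAfter κ p t = p :=
  Function.iterate_fixed h.def t

namespace HardSphere

open PointConfig

variable {d : ℕ} {r lam : ℝ} {Λ τ : Set (EuclideanSpace ℝ (Fin d))}

theorem measurable_removeStep_left (X : configs r Λ τ) :
    Measurable fun x : EuclideanSpace ℝ (Fin d) => removeStep X x :=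
  ((measurable_deleteBall r).comp (measurable_prodMk_left (x := X.1))).subtype_mk

theorem measurable_addStep_left (hΛ : MeasurableSet Λ) (hτ : MeasurableSet τ)
    (X : configs r Λ τ) :
    Measurable (addStep X : EuclideanSpace ℝ (Fin d) → configs r Λ τ) :=
  (measurable_addStep (r := r) hΛ hτ).comp (measurable_prodMk_left (x := X))

theorem singleCenterDynamics_apply (hΛ : MeasurableSet Λ) (hτ : MeasurableSet τ)
    (X : configs r Λ τ) : singleCenterDynamics r lam hΛ hτ X =
      ENNReal.ofReal (1 / (1 + lam)) • (ProbabilityTheory.cond volume Λ).map (removeStep X) +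
      ENNReal.ofReal (lam / (1 + lam)) • (ProbabilityTheory.cond volume Λ).map (addStep X) :=
  rfl

theorem isMarkovKernel_singleCenterDynamics (hlam : 0 ≤ lam) (hΛ : MeasurableSet Λ)
    (hτ : MeasurableSet τ) (hΛpos : volume Λ ≠ 0) (hΛfin : volume Λ ≠ ⊤) :
    IsMarkovKernel (singleCenterDynamics r lam hΛ hτ) := by
  have := cond_isProbabilityMeasure_of_finite hΛpos hΛfin
  refine ⟨fun X => ⟨?_⟩⟩
  have h1 : Measurable (removeStep X) := measurable_removeStep_left X
  have h2 : Measurable (addStep X) := measurable_addStep_left hΛ hτ X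
  rw [singleCenterDynamics_apply, Measure.add_apply, Measure.smul_apply, Measure.smul_apply,
    Measure.map_apply h1 MeasurableSet.univ, Measure.map_apply h2 MeasurableSet.univ]
  simp only [Set.preimage_univ, measure_univ, smul_eq_mul, mul_one]
  rw [← ENNReal.ofReal_add (by positivity) (by positivity), ← add_div, div_self (by positivity),
    ENNReal.ofReal_one]

theorem lintegral_singleCenterDynamics (hΛ : MeasurableSet Λ) (hτ : MeasurableSet τ)
    (X : configs r Λ τ) {h : PointConfig (EuclideanSpace ℝ (Fin d)) → ℝ≥0∞} (hm : Measurable h) :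
    ∫⁻ Y, h Y.1 ∂(singleCenterDynamics r lam hΛ hτ X) =
      ENNReal.ofReal (1 / (1 + lam)) * ((volume Λ)⁻¹ * ∫⁻ x in Λ, h (X.1.deleteBall r x)) +
      ENNReal.ofReal (lam / (1 + lam)) * ((volume Λ)⁻¹ *
        ∫⁻ x in Λ, h (addFree (2 * r) (interiorSet r Λ \ τ) X.1 x)) := by
  have h1 : Measurable (removeStep X) := measurable_removeStep_left X
  have h2 : Measurable (addStep X) := measurable_addStep_left hΛ hτ X
  have hm' : Measurable fun Y : configs r Λ τ => h Y.1 := hm.comp measurable_subtype_coe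
  rw [singleCenterDynamics_apply, lintegral_add_measure, lintegral_smul_measure,
    lintegral_smul_measure, lintegral_map hm' h1,
    lintegral_map hm' h2, ProbabilityTheory.cond, lintegral_smul_measure, lintegral_smul_measure]
  simp_rw [coe_addStep]
  rfl

theorem integral_singleCenterDynamics (hlam : 0 ≤ lam) (hΛ : MeasurableSet Λ)
    (hτ : MeasurableSet τ) (X : configs r Λ τ)
    {g : PointConfig (EuclideanSpace ℝ (Fin d)) → ℝ} (hg : Measurable g) {M : ℝ}
    (hM : ∀ X, |g X| ≤ M) :
    ∫ Y, g Y.1 ∂(singleCenterDynamics r lam hΛ hτ X) =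
      stepOp r lam Λ (interiorSet r Λ \ τ) g X.1 := by
  have h1 : Measurable (removeStep X) := measurable_removeStep_left X
  have h2 : Measurable (addStep X) := measurable_addStep_left hΛ hτ X
  have hm' : Measurable fun Y : configs r Λ τ => g Y.1 := hg.comp measurable_subtype_coe
  have hint : ∀ (μ : Measure (configs r Λ τ)) [IsFiniteMeasure μ],
      Integrable (fun Y => g Y.1) μ := fun μ _ =>
    Integrable.of_bound hm'.aestronglyMeasurable M (Filter.Eventually.of_forall fun Y => hM Y.1)
  rw [singleCenterDynamics_apply, integral_add_measure ((hint _).smul_measure ENNReal.ofReal_ne_top)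
      ((hint _).smul_measure ENNReal.ofReal_ne_top),
    integral_smul_measure, integral_smul_measure,
    integral_map h1.aemeasurable hm'.aestronglyMeasurable,
    integral_map h2.aemeasurable hm'.aestronglyMeasurable, ProbabilityTheory.cond,
    integral_smul_measure, integral_smul_measure, stepOp]
  simp_rw [coe_addStep]
  rw [ENNReal.toReal_ofReal (by positivity), ENNReal.toReal_ofReal (by positivity),
    ENNReal.toReal_inv, ← measureReal_def]
  simp only [smul_eq_mul, mul_inv, removeStep]
  ring

/-- Duality: the law after t steps is tested by iterating `stepOp` on the test function. The
function is defined on all finite configurations, although the chain only visits packings. -/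
theorem integral_lawAfter (hlam : 0 ≤ lam) (hΛ : MeasurableSet Λ) (hΛpos : volume Λ ≠ 0)
    (hΛfin : volume Λ ≠ ⊤) (hτ : MeasurableSet τ)
    {g : PointConfig (EuclideanSpace ℝ (Fin d)) → ℝ} (hg : Measurable g) {M : ℝ}
    (hM : ∀ X, |g X| ≤ M) (t : ℕ) (p : Measure (configs r Λ τ)) [IsProbabilityMeasure p] :
    ∫ Y, g Y.1 ∂(lawAfter (singleCenterDynamics r lam hΛ hτ) p t) =
      ∫ X, (stepOp r lam Λ (interiorSet r Λ \ τ))^[t] g X.1 ∂p := by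
  have := isMarkovKernel_singleCenterDynamics (r := r) hlam hΛ hτ hΛpos hΛfin
  have hA : MeasurableSet (interiorSet r Λ \ τ) := (measurableSet_interiorSet r hΛ).diff hτ
  have hn : 0 < volume.real Λ := ENNReal.toReal_pos hΛpos hΛfin
  have key : ∀ t : ℕ, Measurable ((stepOp r lam Λ (interiorSet r Λ \ τ))^[t] g) ∧
      ∀ X, |(stepOp r lam Λ (interiorSet r Λ \ τ))^[t] g X| ≤ M := by
    intro t
    induction t with
    | zero => exact ⟨hg, hM⟩
    | succ t ih =>
      rw [Function.iterate_succ_apply']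
      exact ⟨measurable_stepOp r lam hA ih.1, abs_stepOp_le hlam hΛfin hn ih.2⟩
  induction t generalizing p with
  | zero => rfl
  | succ t ih =>
    have h1 : lawAfter (singleCenterDynamics r lam hΛ hτ) p (t + 1)
        = lawAfter (singleCenterDynamics r lam hΛ hτ)
          (p.bind (singleCenterDynamics r lam hΛ hτ)) t := rfl
    rw [h1, ih, integral_bind_kernel (singleCenterDynamics r lam hΛ hτ) p
      (f := fun X => (stepOp r lam Λ (interiorSet r Λ \ τ))^[t] g X.1)
      ((key t).1.comp measurable_subtype_coe) fun X => (key t).2 X.1, Function.iterate_succ_apply']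
    exact integral_congr_ae (Filter.Eventually.of_forall fun X =>
      integral_singleCenterDynamics hlam hΛ hτ X (key t).1 (key t).2)

theorem lintegral_hardSphereLaw (hΛ : MeasurableSet Λ) (hτ : MeasurableSet τ)
    (h : PointConfig (EuclideanSpace ℝ (Fin d)) → ℝ≥0∞) :
    ∫⁻ X, h X.1 ∂(hardSphereLaw r lam Λ τ) =
      (poissonProcess lam (interiorSet r Λ \ τ) (packings d r))⁻¹ *
        ∫⁻ X in configs r Λ τ, h X ∂(poissonProcess lam (interiorSet r Λ \ τ)) := by
  have hC := measurableSet_configs r hΛ hτ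
  rw [hardSphereLaw, lintegral_subtype_comap hC, ProbabilityTheory.cond, Measure.restrict_smul,
    lintegral_smul_measure, Measure.restrict_restrict hC,
    Set.inter_eq_left.2 fun X hX => hX.2, smul_eq_mul]

theorem isProbabilityMeasure_hardSphereLaw (hlam : 0 ≤ lam) (hΛ : MeasurableSet Λ)
    (hΛfin : volume Λ ≠ ⊤) (hτ : MeasurableSet τ) :
    IsProbabilityMeasure (hardSphereLaw r lam Λ τ) := by
  have hA : MeasurableSet (interiorSet r Λ \ τ) := (measurableSet_interiorSet r hΛ).diff hτ
  have hAfin : volume (interiorSet r Λ \ τ) ≠ ⊤ :=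
    measure_ne_top_of_subset (fun x hx => hx.1.1) hΛfin
  have := isFiniteMeasure_poissonProcess hlam hAfin
  refine ⟨?_⟩
  have h1 := lintegral_hardSphereLaw (r := r) (lam := lam) hΛ hτ fun _ => 1
  rw [lintegral_one, setLIntegral_one] at h1
  rw [h1]
  -- The Poisson points almost surely lie in the allowed set, so restricting to `configs` loses no
  -- mass.
  have h2 : poissonProcess lam (interiorSet r Λ \ τ) (configs r Λ τ)
      = poissonProcess lam (interiorSet r Λ \ τ) (packings d r) := by
    refine measure_congr ?_
    filter_upwards [ae_poissonProcess_mem (lam := lam) hA hAfin] with X hX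
    exact propext ⟨fun h => h.2, fun h => ⟨hX, h⟩⟩
  rw [h2]
  exact ENNReal.inv_mul_cancel (poissonProcess_packings_ne_zero r) (measure_ne_top _ _)

theorem invariant_hardSphereLaw [NeZero d] (hlam : 0 ≤ lam)
    (hball : ∀ x : EuclideanSpace ℝ (Fin d), volume (Metric.ball x r) = 1)
    (hΛ : MeasurableSet Λ) (hΛpos : volume Λ ≠ 0) (hΛfin : volume Λ ≠ ⊤) (hτ : MeasurableSet τ) :
    (singleCenterDynamics r lam hΛ hτ).Invariant (hardSphereLaw r lam Λ τ) := by
  have hC := measurableSet_configs r hΛ hτ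
  have hA : MeasurableSet (interiorSet r Λ \ τ) := (measurableSet_interiorSet r hΛ).diff hτ
  refine Measure.ext fun s hs => ?_
  have hs' : MeasurableSet (Subtype.val '' s) :=
    (MeasurableEmbedding.subtype_coe hC).measurableSet_image.2 hs
  set h : PointConfig (EuclideanSpace ℝ (Fin d)) → ℝ≥0∞ := (Subtype.val '' s).indicator fun _ => 1
    with hh
  have hm : Measurable h := measurable_const.indicator hs'
  have hval : ∀ ν : Measure (configs r Λ τ), ν s = ∫⁻ X, h X.1 ∂ν := by
    intro ν
    rw [← lintegral_indicator_one hs]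
    refine lintegral_congr fun X => ?_
    by_cases hX : X ∈ s
    · rw [Set.indicator_of_mem hX, hh, Set.indicator_of_mem (Set.mem_image_of_mem _ hX)]
      rfl
    · rw [Set.indicator_of_notMem hX, hh, Set.indicator_of_notMem]
      rintro ⟨Y, hY, hYX⟩
      exact hX (Subtype.ext hYX ▸ hY)
  have hdel : Measurable fun X : PointConfig (EuclideanSpace ℝ (Fin d)) =>
      ∫⁻ x in Λ, h (X.deleteBall r x) :=
    (hm.comp (measurable_deleteBall r)).lintegral_prod_right'
  have hadd : Measurable fun X : PointConfig (EuclideanSpace ℝ (Fin d)) =>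
      ∫⁻ x in Λ, h (addFree (2 * r) (interiorSet r Λ \ τ) X x) :=
    (hm.comp (measurable_addFree (2 * r) hA)).lintegral_prod_right'
  rw [Measure.bind_apply hs (Kernel.aemeasurable _), hval (hardSphereLaw r lam Λ τ)]
  simp_rw [hval, lintegral_singleCenterDynamics hΛ hτ _ hm]
  rw [lintegral_hardSphereLaw hΛ hτ fun X => ENNReal.ofReal (1 / (1 + lam)) *
      ((volume Λ)⁻¹ * ∫⁻ x in Λ, h (X.deleteBall r x)) +
      ENNReal.ofReal (lam / (1 + lam)) * ((volume Λ)⁻¹ *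
        ∫⁻ x in Λ, h (addFree (2 * r) (interiorSet r Λ \ τ) X x)), lintegral_hardSphereLaw hΛ hτ h,
    lintegral_add_left ((hdel.const_mul _).const_mul _), lintegral_const_mul _ (hdel.const_mul _),
    lintegral_const_mul _ hdel, lintegral_const_mul _ (hadd.const_mul _),
    lintegral_const_mul _ hadd]
  congr 1
  have key := setLIntegral_configs_step hlam hball hΛ hΛfin hτ hm
    (Set.indicator_le_self' fun _ _ => zero_le)
  have hl : ENNReal.ofReal (lam / (1 + lam))
      = ENNReal.ofReal (1 / (1 + lam)) * ENNReal.ofReal lam := by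
    rw [← ENNReal.ofReal_mul (by positivity)]
    congr 1
    ring
  have hl1 : ENNReal.ofReal (1 / (1 + lam)) * (1 + ENNReal.ofReal lam) = 1 := by
    rw [← ENNReal.ofReal_one, ← ENNReal.ofReal_add zero_le_one hlam,
      ← ENNReal.ofReal_mul (by positivity), one_div, inv_mul_cancel₀ (by positivity)]
  have hring : ∀ o v i l j : ℝ≥0∞, o * (v * i) + o * l * (v * j) = o * v * (i + l * j) := by
    intros; ring
  have hring' : ∀ o v n l i : ℝ≥0∞, o * v * (n * l * i) = (o * l) * (v * n) * i := by
    intros; ring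
  rw [hl, hring, key, hring', hl1, ENNReal.inv_mul_cancel hΛpos hΛfin, one_mul, one_mul]

end HardSphere

/-! ### Explicit constants and the distance between two laws. -/

namespace HardSphere

open PointConfig

variable {d : ℕ} {r γ lam : ℝ} {Λ τ : Set (EuclideanSpace ℝ (Fin d))}

theorem volume_ball_two_mul [NeZero d]
    (hball : ∀ x : EuclideanSpace ℝ (Fin d), volume (Metric.ball x r) = 1)
    (x : EuclideanSpace ℝ (Fin d)) :
    volume (Metric.ball x (2 * r)) = ENNReal.ofReal (2 ^ d) := by
  rw [Measure.addHaar_ball_mul_of_pos _ _ two_pos, hball 0, finrank_euclideanSpace_fin, mul_one]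

/-- The constants give a + cD = 1 and a - cD = γ/2: the weights are at most 1, and the drift at F =
0 is exactly -γ/2. -/
theorem FreeLipschitz.stepOp_exp [NeZero d] (hγ : γ ∈ Set.Ioo (0 : ℝ) 1) (hlam0 : 0 ≤ lam)
    (hlam1 : lam ≤ 1) (hlamD : lam * 2 ^ d = 2 * (1 - γ)) (hr : 0 < r)
    (hball : ∀ x : EuclideanSpace ℝ (Fin d), volume (Metric.ball x r) = 1)
    (hΛ : MeasurableSet Λ) (hΛpos : volume Λ ≠ 0) (hΛfin : volume Λ ≠ ⊤) (hτ : MeasurableSet τ)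
    {g : PointConfig (EuclideanSpace ℝ (Fin d)) → ℝ} {L M : ℝ} (hL : 0 ≤ L)
    (hg : FreeLipschitz (2 * r) (1 / 2 + γ / 4) ((1 / 2 - γ / 4) / 2 ^ d)
      (interiorSet r Λ \ τ) L g) (hgm : Measurable g) (hM : ∀ X, |g X| ≤ M) :
    FreeLipschitz (2 * r) (1 / 2 + γ / 4) ((1 / 2 - γ / 4) / 2 ^ d)
      (interiorSet r Λ \ τ) (L * Real.exp (-(γ / (4 * volume.real Λ))))
      (HardSphere.stepOp r lam Λ (interiorSet r Λ \ τ) g) := by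
  obtain ⟨hγ0, hγ1⟩ := hγ
  have hn : 0 < volume.real Λ := ENNReal.toReal_pos hΛpos hΛfin
  have hA : MeasurableSet (interiorSet r Λ \ τ) := (measurableSet_interiorSet r hΛ).diff hτ
  set D : ℝ := 2 ^ d with hDdef
  have hD0 : 0 < D := by positivity
  set c := (1 / 2 - γ / 4) / D with hc
  have hcD : c * D = 1 / 2 - γ / 4 := div_mul_cancel₀ _ hD0.ne'
  have hc0 : 0 ≤ c := div_nonneg (by linarith) hD0.le
  have h1 := hg.stepOp (lam := lam) (δ := γ / 2) hc0 hL hlam0 (by linarith) hΛ hΛfin hn hA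
    (fun v hv => ball_subset_of_mem_interiorSet hv.1) hr hball (volume_ball_two_mul hball) hD0.le
    (by linarith) (fun F hF0 hFD => by
      have hu : F = (F / D) * D := (div_mul_cancel₀ _ hD0.ne').symm
      have hu0 : 0 ≤ F / D := by positivity
      have hu1 : F / D ≤ 1 := (div_le_one hD0).2 hFD
      set u := F / D
      have e1 : c * F = u * (1 / 2 - γ / 4) := by rw [hu, ← hcD]; ring
      have e2 : lam * (1 / 2 + γ / 4) * F = u * ((1 / 2 + γ / 4) * (2 * (1 - γ))) := by
        rw [hu, ← hlamD]; ring
      rw [mul_assoc, e1, hcD, e2]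
      -- With u = F/D, the drift equals -γ/2 - uγ²/2.
      nlinarith [mul_nonneg hu0 (sq_nonneg γ)]) hgm hM
  intro X v hv
  refine (h1 X v hv).trans ?_
  have hΦ : 0 ≤ 1 / 2 + γ / 4 + c * freeVol (2 * r) (interiorSet r Λ \ τ) v X := by
    have : 0 ≤ freeVol (2 * r) (interiorSet r Λ \ τ) v X := measureReal_nonneg
    positivity
  refine mul_le_mul_of_nonneg_right (mul_le_mul_of_nonneg_left ?_ hL) hΦ
  -- Uses 1 + λ ≤ 2.
  have h2 : γ / (4 * volume.real Λ) ≤ γ / 2 / (volume.real Λ * (1 + lam)) := by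
    rw [div_div]
    refine div_le_div_of_nonneg_left hγ0.le (by positivity) ?_
    nlinarith
  have h3 := Real.add_one_le_exp (-(γ / (4 * volume.real Λ)))
  linarith

/-- For an event with indicator g, the t-th iterate of g stays within 2nρ^t of its value at the
empty configuration. Integrating against both initial laws doubles this to 4nρ^t. -/
theorem abs_lawAfter_sub_le [NeZero d] (hγ : γ ∈ Set.Ioo (0 : ℝ) 1) (hlam0 : 0 ≤ lam)
    (hlam1 : lam ≤ 1) (hlamD : lam * 2 ^ d = 2 * (1 - γ)) (hr : 0 < r)
    (hball : ∀ x : EuclideanSpace ℝ (Fin d), volume (Metric.ball x r) = 1)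
    (hΛ : MeasurableSet Λ) (hΛpos : volume Λ ≠ 0) (hΛfin : volume Λ ≠ ⊤) (hτ : MeasurableSet τ)
    (p q : Measure (configs r Λ τ)) [IsProbabilityMeasure p] [IsProbabilityMeasure q] (t : ℕ)
    {s : Set (configs r Λ τ)} (hs : MeasurableSet s) :
    |(lawAfter (singleCenterDynamics r lam hΛ hτ) p t).real s -
        (lawAfter (singleCenterDynamics r lam hΛ hτ) q t).real s|
      ≤ 4 * volume.real Λ * Real.exp (-(t * (γ / (4 * volume.real Λ)))) := by
  have hC := measurableSet_configs r hΛ hτ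
  have hn : 0 < volume.real Λ := ENNReal.toReal_pos hΛpos hΛfin
  have hA : MeasurableSet (interiorSet r Λ \ τ) := (measurableSet_interiorSet r hΛ).diff hτ
  have hs' : MeasurableSet (Subtype.val '' s) :=
    (MeasurableEmbedding.subtype_coe hC).measurableSet_image.2 hs
  set g : PointConfig (EuclideanSpace ℝ (Fin d)) → ℝ := (Subtype.val '' s).indicator fun _ => 1
    with hgdef
  have hgm : Measurable g := measurable_const.indicator hs'
  have hg0 : ∀ X, 0 ≤ g X := Set.indicator_nonneg fun _ _ => zero_le_one
  have hg1 : ∀ X, g X ≤ 1 := Set.indicator_le_self' fun _ _ => zero_le_one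
  have hM : ∀ X, |g X| ≤ 1 := fun X => by rw [abs_of_nonneg (hg0 X)]; exact hg1 X
  have hval : ∀ ν : Measure (configs r Λ τ), ν.real s = ∫ X, g X.1 ∂ν := by
    intro ν
    rw [← integral_indicator_one hs]
    refine integral_congr_ae (Filter.Eventually.of_forall fun X => ?_)
    by_cases hX : X ∈ s
    · simp only [Set.indicator_of_mem hX, hgdef, Set.indicator_of_mem (Set.mem_image_of_mem _ hX)]
      rfl
    · have : X.1 ∉ Subtype.val '' s := by
        rintro ⟨Y, hY, hYX⟩
        exact hX (Subtype.ext hYX ▸ hY)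
      simp only [Set.indicator_of_notMem hX, hgdef, Set.indicator_of_notMem this]
  set T := stepOp r lam Λ (interiorSet r Λ \ τ)
  set a := 1 / 2 + γ / 4 with ha
  set c := (1 / 2 - γ / 4) / (2 : ℝ) ^ d with hc
  have hc0 : 0 ≤ c := div_nonneg (by linarith [hγ.2]) (by positivity)
  have hΦ : ∀ v X, a + c * freeVol (2 * r) (interiorSet r Λ \ τ) v X ≤ 1 := by
    intro v X
    have h1 : freeVol (2 * r) (interiorSet r Λ \ τ) v X ≤ 2 ^ d := by
      have h2 := volume_ball_two_mul hball v
      have h3 : volume.real (Metric.ball v (2 * r)) = 2 ^ d := by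
        rw [measureReal_def, h2, ENNReal.toReal_ofReal (by positivity)]
      rw [← h3]
      exact measureReal_mono Set.inter_subset_right (h2 ▸ ENNReal.ofReal_ne_top)
    have h2 : c * 2 ^ d = 1 / 2 - γ / 4 := div_mul_cancel₀ _ (by positivity)
    have h3 := mul_le_mul_of_nonneg_left h1 hc0
    linarith
  set ρ := Real.exp (-(γ / (4 * volume.real Λ)))
  have key : ∀ t : ℕ, Measurable (T^[t] g) ∧ (∀ X, |T^[t] g X| ≤ 1) ∧
      FreeLipschitz (2 * r) a c (interiorSet r Λ \ τ) (2 * ρ ^ t) (T^[t] g) := by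
    intro t
    induction t with
    | zero =>
      refine ⟨hgm, hM, fun X v _ => ?_⟩
      -- The initial constant 2 suffices: an indicator changes by at most 1, and every weight is at
      -- least a ≥ 1/2.
      have h1 : |g (X.add v) - g X| ≤ 1 :=
        abs_sub_le_of_nonneg_of_le (hg0 _) (hg1 _) (hg0 _) (hg1 _)
      have h2 : 0 ≤ c * freeVol (2 * r) (interiorSet r Λ \ τ) v X :=
        mul_nonneg hc0 measureReal_nonneg
      have := hγ.1
      simp only [Function.iterate_zero, id, pow_zero]
      linarith
    | succ t ih =>
      obtain ⟨h1, h2, h3⟩ := ih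
      rw [Function.iterate_succ_apply', pow_succ, ← mul_assoc]
      exact ⟨measurable_stepOp r lam hA h1, abs_stepOp_le hlam0 hΛfin hn h2,
        h3.stepOp_exp hγ hlam0 hlam1 hlamD hr hball hΛ hΛpos hΛfin hτ (by positivity) h1 h2⟩
  obtain ⟨h1, h2, h3⟩ := key t
  rw [hval, hval, integral_lawAfter hlam0 hΛ hΛpos hΛfin hτ hgm hM,
    integral_lawAfter hlam0 hΛ hΛpos hΛfin hτ hgm hM]
  have h4 : ∀ X : configs r Λ τ, |T^[t] g X.1 - T^[t] g ⟨∅⟩| ≤ volume.real Λ * (2 * ρ ^ t) := by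
    intro X
    refine (h3.abs_sub_empty_le (by positivity) hΦ X.1 X.2.1).trans ?_
    refine mul_le_mul_of_nonneg_right ?_ (by positivity)
    have := ENNReal.toReal_mono hΛfin (card_points_le hball X.2)
    rwa [ENNReal.toReal_natCast, ← measureReal_def] at this
  have h5 : ∀ ν : Measure (configs r Λ τ), IsProbabilityMeasure ν →
      |∫ X, T^[t] g X.1 ∂ν - T^[t] g ⟨∅⟩| ≤ volume.real Λ * (2 * ρ ^ t) := by
    intro ν _
    have hint : Integrable (fun X : configs r Λ τ => T^[t] g X.1) ν :=
      Integrable.of_bound (h1.comp measurable_subtype_coe).aestronglyMeasurable 1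
        (Filter.Eventually.of_forall fun X => h2 X.1)
    have h6 : ∫ X, T^[t] g X.1 ∂ν - T^[t] g ⟨∅⟩ =
        ∫ X : configs r Λ τ, (T^[t] g X.1 - T^[t] g ⟨∅⟩) ∂ν := by
      rw [integral_sub hint (integrable_const _)]
      simp
    rw [h6]
    have := norm_integral_le_of_norm_le_const (μ := ν)
      (f := fun X : configs r Λ τ => T^[t] g X.1 - T^[t] g ⟨∅⟩) (Filter.Eventually.of_forall h4)
    simpa using this
  have h7 : Real.exp (-(t * (γ / (4 * volume.real Λ)))) = ρ ^ t := by
    rw [← Real.exp_nat_mul, mul_neg]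
  rw [h7]
  have h8 := abs_le.1 (h5 p inferInstance)
  have h9 := abs_le.1 (h5 q inferInstance)
  rw [abs_le]
  constructor <;> linarith [h8.1, h8.2, h9.1, h9.2]

end HardSphere

/-! ### Uniqueness and the mixing time. -/

theorem mainTheorem3 {d : ℕ} (hd : 1 ≤ d)
    (r : ℝ) (hr : volume (Metric.ball (0 : EuclideanSpace ℝ (Fin d)) r) = 1)
    (Λ : Set (EuclideanSpace ℝ (Fin d))) (hΛ : IsCompact Λ) (hΛpos : volume Λ ≠ 0)
    (n : ℝ) (hn : n = volume.real Λ)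
    (γ : ℝ) (hγ : γ ∈ Set.Ioo (0 : ℝ) 1)
    (lam : ℝ) (hlam : lam = (1 - γ) * (2 : ℝ) ^ (1 - (d : ℤ)))
    (τ : Set (EuclideanSpace ℝ (Fin d))) (hτ : MeasurableSet τ)
    (hτΛ : τ ⊆ HardSphere.interiorSet r Λ) :
    (IsProbabilityMeasure (HardSphere.hardSphereLaw r lam Λ τ) ∧
      ∀ π : Measure (HardSphere.configs r Λ τ), IsProbabilityMeasure π →
        ((HardSphere.singleCenterDynamics r lam hΛ.measurableSet hτ).Invariant π ↔
          π = HardSphere.hardSphereLaw r lam Λ τ)) ∧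
    ∀ ε : ℝ, 0 < ε →
      mixingTime (HardSphere.singleCenterDynamics r lam hΛ.measurableSet hτ)
          (HardSphere.hardSphereLaw r lam Λ τ) ε ≤
        ((⌈4 * n * (Real.log ((2 : ℝ) ^ (d + 2) * n) + Real.log (1 / ε)) / γ⌉₊ : ℕ) : ℕ∞) := by
  have : NeZero d := ⟨by omega⟩
  have hΛm := hΛ.measurableSet
  have hΛfin : volume Λ ≠ ⊤ := hΛ.measure_lt_top.ne
  have hn0 : 0 < n := hn ▸ ENNReal.toReal_pos hΛpos hΛfin
  have hr0 : 0 < r := by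
    by_contra h
    rw [Metric.ball_eq_empty.2 (not_lt.1 h)] at hr
    simp at hr
  have hball : ∀ x : EuclideanSpace ℝ (Fin d), volume (Metric.ball x r) = 1 := fun x => by
    rw [Measure.addHaar_ball_center, hr]
  have hlamD : lam * 2 ^ d = 2 * (1 - γ) := by
    rw [hlam, zpow_sub₀ two_ne_zero, zpow_one, zpow_natCast]
    field_simp
  have hlam0 : 0 ≤ lam := by
    rw [hlam]
    have := hγ.2
    exact mul_nonneg (by linarith) (by positivity)
  have hlam1 : lam ≤ 1 := by
    have h1 : (2 : ℝ) ≤ 2 ^ d := by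
      simpa using pow_le_pow_right₀ (one_le_two : (1 : ℝ) ≤ 2) hd
    have h2 := hγ.1
    nlinarith
  have hprob := HardSphere.isProbabilityMeasure_hardSphereLaw (r := r) hlam0 hΛm hΛfin hτ
  have hinv := HardSphere.invariant_hardSphereLaw hlam0 hball hΛm hΛpos hΛfin hτ
  have hbound := fun (p : Measure (HardSphere.configs r Λ τ)) (hp : IsProbabilityMeasure p) t s
      (hs : MeasurableSet s) => HardSphere.abs_lawAfter_sub_le hγ hlam0 hlam1 hlamD hr0 hball hΛm
        hΛpos hΛfin hτ p (HardSphere.hardSphereLaw r lam Λ τ) t hs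
  -- Started from the stationary law, the second chain never moves in law.
  simp only [lawAfter_eq_self hinv, ← hn] at hbound
  refine ⟨⟨hprob, fun π hπ => ⟨fun h => ?_, fun h => h ▸ hinv⟩⟩, fun ε hε => ?_⟩
  · refine Measure.ext fun s hs => (measureReal_eq_measureReal_iff).1 ?_
    have hγ0 := hγ.1
    -- A stationary π also equals its law after t steps, so its discrepancy from the hard sphere law
    -- lies below a bound tending to 0.
    have hlim : Filter.Tendsto (fun t : ℕ => 4 * n * Real.exp (-(t * (γ / (4 * n)))))
        Filter.atTop (nhds 0) := by
      have h1 : Filter.Tendsto (fun t : ℕ => (t : ℝ) * (γ / (4 * n))) Filter.atTop Filter.atTop :=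
        tendsto_natCast_atTop_atTop.atTop_mul_const (by positivity)
      simpa using (Real.tendsto_exp_neg_atTop_nhds_zero.comp h1).const_mul (4 * n)
    have h2 := ge_of_tendsto' hlim fun t => lawAfter_eq_self h t ▸ hbound π hπ t s hs
    exact sub_eq_zero.1 (abs_nonpos_iff.1 h2)
  · set b := 4 * n * (Real.log ((2 : ℝ) ^ (d + 2) * n) + Real.log (1 / ε)) / γ with hb
    -- The natural-number ceiling is 0 for negative b, which accounts for the maximum with 0.
    refine iSup_le fun p => iInf₂_le ⌈b⌉₊ ?_
    have hnonempty : Nonempty {A : Set (HardSphere.configs r Λ τ) // MeasurableSet A} :=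
      ⟨⟨∅, MeasurableSet.empty⟩⟩
    refine ciSup_le fun A => (hbound p.1 p.2 ⌈b⌉₊ A.1 A.2).trans ?_
    have h1 : b ≤ ⌈b⌉₊ := Nat.le_ceil b
    have hγ0 := hγ.1
    have h2 : b * (γ / (4 * n)) = Real.log ((2 : ℝ) ^ (d + 2) * n) + Real.log (1 / ε) := by
      rw [hb]; field_simp
    have h3 := mul_le_mul_of_nonneg_right h1 (show 0 ≤ γ / (4 * n) by positivity)
    rw [h2] at h3
    calc 4 * n * Real.exp (-(⌈b⌉₊ * (γ / (4 * n))))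
        ≤ 4 * n * Real.exp (-(Real.log ((2 : ℝ) ^ (d + 2) * n) + Real.log (1 / ε))) := by
          gcongr
      _ = 4 * n * (ε / (2 ^ (d + 2) * n)) := by
          rw [← Real.log_mul (by positivity) (by positivity), ← Real.log_inv,
            Real.exp_log (by positivity)]
          field_simp
      _ = ε / 2 ^ d := by
          field_simp
          ring
      -- The factor 2^d in the logarithm is slack: 4n in place of 2^{d+2}n would already give ε.
      _ ≤ ε := div_le_self hε.le (one_le_pow₀ one_le_two)
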